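/- \textbf{Setting.} Let $L$ be a smooth (Hausdorff, second countable, finite-dimensional) manifold without boundary and $(\xi,J)$ a Levi flat structure on $L$: $\xi\subset TL$ is an integrable (involutive) distribution of codimension $1$ and $J$ is a smooth bundle endomorphism of $\xi$ with $J^2=-1$ and vanishing Nijenhuis tensor (so every leaf is a complex manifold). Write $\mathcal H(L)$ for the vector fields on $L$, $\mathcal H(\xi)$ for those tangent to $\xi$, and $\Lambda^{0,1}_J(\xi)\otimes\xi$ for the $C^\infty(L)$-linear maps $P:\mathcal H(\xi)\to\mathcal H(\xi)$ with $PJ=-JP$. For $V,W\in\mathcal H(\xi)$ put $$\overline\partial W(V)=\tfrac12\big([V,W]+J[JV,W]\big),\qquad \overline\partial P(V,W)=\overline\partial(P(W))(V)-\overline\partial(P(V))(W)-\tfrac12P\big([V,W]-[JV,JW]\big),$$ and let $H^1(\Lambda^{0,*}_J(\xi)\otimes\xi,\overline\partial_J)$ be the kernel of the second operator modulo the image of the first. For a $1$-form $\beta$ and $U\in\mathcal H(\xi)$ let $(\beta^{0,1}\otimes U)(V)=\tfrac12(\beta(V)U+\beta(JV)JU)$, and $(\beta^{0,1}\wedge P)(V,W)=(\beta^{0,1}\otimes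 P(W))(V)-(\beta^{0,1}\otimes P(V))(W)$. A DGLA defining couple $(\gamma,X)$ is a $1$-form $\gamma$ with $\ker\gamma=\xi$ and a vector field $X$ with $\gamma(X)=1$. It determines: - $\mathcal Z^0(L)=C^\infty(L)$, $\mathcal Z^1(L)=\{\alpha\in\Lambda^1(L):\alpha(X)=0\}$, the bracket $\{\alpha,\beta\}=\mathcal L_X\alpha\wedge\beta-\alpha\wedge\mathcal L_X\beta$, the differential $\delta=d+\{\gamma,\cdot\}$, and $H^1(\mathcal Z^*(L),\delta)=\ker(\delta|_{\mathcal Z^1})/\delta(\mathcal Z^0)$; - for $Y\in\mathcal H(L)$, with $T_Y(V)=[V,Y]-\gamma([V,Y])X$, the form $H_Y(V)=\tfrac12(T_Y(V)+JT_Y(JV))$ in $\Lambda^{0,1}_J(\xi)\otimes\xi$; put $H=H_{J,\gamma,X}:=H_X$; - $\mathcal A$, the space of pairs $(\beta,P)\in\mathcal Z^1(L)\oplus\Lambda^{0,1}_J(\xi)\otimes\xi$ with $\delta\beta=0$ and $\overline\partial P=-\beta^{0,1}\wedge H$, and the relation $(\beta,P)\sim(\beta',P')$ iff there is $Y\in\mathcal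 H(L)$ with $\beta-\beta'=\delta(\gamma(Y))$ and $P-P'=-H_Y$; - the operators $\mathfrak d^0(\varphi,V)=(\delta\varphi,\overline\partial V-\varphi H)$ on $C^\infty(L)\oplus\mathcal H(\xi)$ and $\mathfrak d^1(\alpha,P)=(\delta\alpha,\overline\partial P+\alpha^{0,1}\wedge H)$, so that $\mathcal A=\ker\mathfrak d^1$; put $H^1(\mathfrak Z,\mathfrak d)=\ker\mathfrak d^1/\operatorname{im}\mathfrak d^0$; - the Maurer--Cartan set $\mathfrak{MC}$ of pairs $(\alpha,S)\in\mathcal Z^1(L)\oplus\Lambda^{0,1}_J(\xi)\otimes\xi$ with $\delta\alpha+\tfrac12\{\alpha,\alpha\}=0$ and $\overline\partial^\alpha S+\tfrac12[[S,S]]_\alpha=-\alpha^{0,1}\wedge H$. Here $[V,W]_\alpha=\omega_\alpha^{-1}[\omega_\alpha V,\omega_\alpha W]$ with $\omega_\alpha(V)=V-\alpha(V)X$; $N_\alpha(V,W)=[JV,JW]_\alpha-[V,W]_\alpha-J[JV,W]_\alpha-J[V,JW]_\alpha$; $\overline\partial^\alpha W(V)=\tfrac12([V,W]_\alpha+J[JV,W]_\alpha)+\tfrac14N_\alpha(V,W)$;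 $\overline\partial^\alpha S(V,W)=\overline\partial^\alpha(S(W))(V)-\overline\partial^\alpha(S(V))(W)-\tfrac12S([V,W]_\alpha-[JV,JW]_\alpha)$; $$[S,S]_\alpha(V,W)=[SV,SW]_\alpha-[JSV,JSW]_\alpha-S\big([SV,W]_\alpha+[V,SW]_\alpha+J[V,JSW]_\alpha+J[JSV,W]_\alpha\big)-\tfrac12\big(S(N_\alpha(SV,W)+N_\alpha(V,SW))-N_\alpha(SV,SW)\big);$$ and $[[S,S]]_\alpha(V,W)=[S,S]_\alpha(V,W)-\tfrac12S\big(N_\alpha(V,W)-N_\alpha(SV,SW)\big)$; - the set $T_{[0]}(\mathfrak{MC}/\!\sim)$ of infinitesimal deformations: the classes in $H^1(\mathfrak Z,\mathfrak d)$ of the tangent vectors at $0$ of smooth curves $\lambda:[-a,a]\to\mathfrak{MC}$, $a>0$, $\lambda(0)=0$. $(\xi,J)$ is called exact if $H_{J,\gamma,X}=0$ for some DGLA defining couple $(\gamma,X)$. \textbf{Statement.} Let $(\xi,J)$ be an exact Levi flat structure on $L$. 0) For every DGLA defining couple, the tangent vectors at $0$ of smooth $\mathfrak{MC}$-valued curves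 through $0$ lie in $\mathcal A$ (so that their classes in $H^1(\mathfrak Z,\mathfrak d)$ are defined). 1) If $(\gamma,X)$ is a DGLA defining couple with $H_{J,\gamma,X}=0$, then $(\beta,P)\mapsto([\beta],[P])$ induces a well-defined isomorphism of real vector spaces $$\mathcal A/\!\sim\ \longrightarrow\ H^1(\mathcal Z^*(L),\delta)\times H^1(\Lambda^{0,*}_J(\xi)\otimes\xi,\overline\partial_J),$$ and the same formula on representatives in $\mathcal A$ gives a well-defined injection $T_{[0]}(\mathfrak{MC}/\!\sim)\hookrightarrow H^1(\mathcal Z^*(L),\delta)\times H^1(\Lambda^{0,*}_J(\xi)\otimes\xi,\overline\partial_J)$. 2) If $(\gamma,X)$ is an arbitrary DGLA defining couple, there is $U\in\mathcal H(\xi)$ with $H_{J,\gamma,X}=\overline\partial U-(\iota_Xd\gamma)^{0,1}\otimes U$. For every such $U$, the formula $(\beta,P)\mapsto([\beta],[P-\beta^{0,1}\otimes U])$ induces a well-defined isomorphism of $\mathcal A/\!\sim$ onto $H^1(\mathcal Z^*(L),\delta)\times H^1(\Lambda^{0,*}_J(\xi)\otimes\xi,\overline\partial_J)$ and, on representatives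 in $\mathcal A$, a well-defined injection of $T_{[0]}(\mathfrak{MC}/\!\sim)$ into this product. -/

import Mathlib

open scoped Manifold ContDiff

namespace LeviFlat

noncomputable section

set_option linter.unusedSectionVars false

section Manifold

variable (E : Type*) [NormedAddCommGroup E] [NormedSpace ℝ E]
  (L : Type*) [TopologicalSpace L] [ChartedSpace E L]

/-- The algebra `C^∞(L)` of smooth real functions on `L`. -/
abbrev SmoothFn := C^∞⟮𝓘(ℝ, E), L; 𝓘(ℝ, ℝ), ℝ⟯

/-- The smooth vector fields on `L`. -/
abbrev VField [IsManifold 𝓘(ℝ, E) ∞ L] :=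
  Cₛ^∞⟮𝓘(ℝ, E); E, (TangentSpace 𝓘(ℝ, E) : L → Type _)⟯

end Manifold

section Calculus

variable {E : Type*} [NormedAddCommGroup E] [NormedSpace ℝ E] [FiniteDimensional ℝ E]
  {L : Type*} [TopologicalSpace L] [ChartedSpace E L] [IsManifold 𝓘(ℝ, E) ∞ L]

/-- The pointwise product of a smooth function and a vector field. -/
instance : SMul (SmoothFn E L) (VField E L) where
  smul f V := ⟨fun x => f x • V x, f.contMDiff.smul_section V.contMDiff⟩

@[simp] theorem smul_apply (f : SmoothFn E L) (V : VField E L) (x : L) :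
    (f • V) x = f x • V x := rfl

/-- Vector fields form a module over smooth functions. -/
instance : Module (SmoothFn E L) (VField E L) where
  one_smul V := by ext x; simp
  mul_smul f g V := by ext x; simp [mul_smul]
  smul_zero f := by ext x; simp
  smul_add f V W := by ext x; simp
  add_smul f g V := by ext x; simp [add_smul]
  zero_smul V := by ext x; simp

instance : IsScalarTower ℝ (SmoothFn E L) (VField E L) where
  smul_assoc c f V := by ext x; simp [mul_smul]

theorem mdiff_vfield (V : VField E L) (x : L) :
    MDifferentiableAt 𝓘(ℝ, E) 𝓘(ℝ, E).tangent
      (fun y => (⟨y, V y⟩ : TangentBundle 𝓘(ℝ, E) L)) x :=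
  V.contMDiff.mdifferentiableAt (by simp)

theorem mdiff_fn (f : SmoothFn E L) (x : L) : MDifferentiableAt 𝓘(ℝ, E) 𝓘(ℝ, ℝ) f x :=
  f.contMDiff.mdifferentiableAt (by simp)

/-- The Lie bracket of vector fields. -/
def lie (V W : VField E L) : VField E L :=
  ⟨fun x => VectorField.mlieBracket 𝓘(ℝ, E) V W x, by
    have : CompleteSpace E := FiniteDimensional.complete ℝ E
    have : IsManifold 𝓘(ℝ, E) (minSmoothness ℝ 2) L := by
      rw [minSmoothness_of_isRCLikeNormedField]; infer_instance
    have : IsManifold 𝓘(ℝ, E) (((⊤ : ℕ∞) : WithTop ℕ∞) + 1) L := by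
      simpa using (inferInstance : IsManifold 𝓘(ℝ, E) ∞ L)
    exact ContDiff.mlieBracket_vectorField (n := ⊤) (m := ⊤) V.contMDiff W.contMDiff
      (by rw [minSmoothness_of_isRCLikeNormedField]; simp)⟩

/-- The derivative `V f` of a smooth function along a vector field. -/
def der (V : VField E L) (f : SmoothFn E L) : SmoothFn E L :=
  ⟨fun x => mvfderiv 𝓘(ℝ, E) f x (V x), by
    have h1 : ContMDiff 𝓘(ℝ, E).tangent 𝓘(ℝ, ℝ).tangent ∞ (tangentMap 𝓘(ℝ, E) 𝓘(ℝ, ℝ) f) :=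
      f.contMDiff.contMDiff_tangentMap (m := ∞) (by simp)
    have h2 := h1.comp V.contMDiff
    have h3 := (contMDiff_snd_tangentBundle_modelSpace ℝ 𝓘(ℝ, ℝ) (n := ∞)).comp h2
    exact h3⟩
theorem lie_apply (V W : VField E L) (x : L) :
    lie V W x = VectorField.mlieBracket 𝓘(ℝ, E) V W x := rfl

theorem der_apply (V : VField E L) (f : SmoothFn E L) (x : L) :
    der V f x = mvfderiv 𝓘(ℝ, E) f x (V x) := rfl

theorem lie_swap (V W : VField E L) : lie V W = -lie W V := by
  ext x
  simp only [lie_apply, ContMDiffSection.coe_neg, Pi.neg_apply]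
  exact VectorField.mlieBracket_swap_apply

theorem lie_self (V : VField E L) : lie V V = 0 := by
  ext x
  rw [lie_apply, VectorField.mlieBracket_self]
  rfl

theorem lie_add_right (V W W' : VField E L) : lie V (W + W') = lie V W + lie V W' := by
  have : CompleteSpace E := FiniteDimensional.complete ℝ E
  ext x
  simp only [lie_apply, ContMDiffSection.coe_add, Pi.add_apply]
  exact VectorField.mlieBracket_add_right (mdiff_vfield W x) (mdiff_vfield W' x)

theorem lie_smul_right (V : VField E L) (f : SmoothFn E L) (W : VField E L) :
    lie V (f • W) = f • lie V W + der V f • W := by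
  have : CompleteSpace E := FiniteDimensional.complete ℝ E
  ext x
  simp only [lie_apply, ContMDiffSection.coe_add, Pi.add_apply, smul_apply, der_apply]
  rw [add_comm]
  exact VectorField.mlieBracket_smul_right (mdiff_fn f x) (mdiff_vfield W x)

theorem lie_add_left (V V' W : VField E L) : lie (V + V') W = lie V W + lie V' W := by
  rw [lie_swap, lie_add_right, lie_swap W V, lie_swap W V']; abel

theorem lie_smul_left (f : SmoothFn E L) (V W : VField E L) :
    lie (f • V) W = f • lie V W - der W f • V := by
  rw [lie_swap, lie_smul_right, lie_swap W V, smul_neg]; abel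

theorem der_add_left (V W : VField E L) (f : SmoothFn E L) :
    der (V + W) f = der V f + der W f := by
  ext x
  simp [der_apply]

theorem der_smul_left (g : SmoothFn E L) (V : VField E L) (f : SmoothFn E L) :
    der (g • V) f = g * der V f := by
  ext x
  simp [der_apply]

theorem der_add (V : VField E L) (f g : SmoothFn E L) :
    der V (f + g) = der V f + der V g := by
  ext x
  simp only [der_apply, ContMDiffMap.coe_add, Pi.add_apply]
  rw [mvfderiv_add (mdiff_fn f x) (mdiff_fn g x)]
  rfl

theorem der_mul (V : VField E L) (f g : SmoothFn E L) :
    der V (f * g) = f * der V g + der V f * g := by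
  ext x
  simp only [der_apply, ContMDiffMap.coe_add, ContMDiffMap.coe_mul, Pi.add_apply, Pi.mul_apply]
  rw [mvfderiv_mul (mdiff_fn f x) (mdiff_fn g x), mul_comm (mvfderiv _ _ _ _)]
  rfl

theorem der_algebraMap (V : VField E L) (c : ℝ) : der V (algebraMap ℝ (SmoothFn E L) c) = 0 := by
  ext x
  exact congrArg (fun T : TangentSpace 𝓘(ℝ, E) x →L[ℝ] ℝ => T (V x)) (mvfderiv_const c)

theorem der_one (V : VField E L) : der V (1 : SmoothFn E L) = 0 := by
  simpa using der_algebraMap V 1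

theorem der_real_smul (V : VField E L) (c : ℝ) (f : SmoothFn E L) :
    der V (c • f) = c • der V f := by
  rw [Algebra.smul_def, der_mul, der_algebraMap, Algebra.smul_def]; simp

theorem lie_real_smul_right (V : VField E L) (c : ℝ) (W : VField E L) :
    lie V (c • W) = c • lie V W := by
  rw [algebra_compatible_smul (SmoothFn E L) c W, lie_smul_right, der_algebraMap, zero_smul,
    add_zero, algebraMap_smul]

end Calculus

section Forms

variable (E : Type*) [NormedAddCommGroup E] [NormedSpace ℝ E] [FiniteDimensional ℝ E]
  (L : Type*) [TopologicalSpace L] [ChartedSpace E L] [IsManifold 𝓘(ℝ, E) ∞ L]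

/-- Smooth `1`-forms on `L`, as `C^∞(L)`-linear functionals on vector fields. -/
abbrev OneForm := VField E L →ₗ[SmoothFn E L] SmoothFn E L

/-- The target of the differentials on `1`-forms: `C^∞(L)`-bilinear functionals on vector fields.
The values of the differentials below are alternating, i.e. they are smooth `2`-forms. -/
abbrev BilinForm := VField E L →ₗ[SmoothFn E L] VField E L →ₗ[SmoothFn E L] SmoothFn E L

variable {E L}

/-- The differential of a function. -/
def dFn (f : SmoothFn E L) : OneForm E L where
  toFun V := der V f
  map_add' V W := der_add_left V W f
  map_smul' g V := der_smul_left g V f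

/-- The exterior derivative of a `1`-form:
`dα(V, W) = V(α(W)) - W(α(V)) - α([V, W])`. -/
def dForm (α : OneForm E L) : BilinForm E L :=
  LinearMap.mk₂ (SmoothFn E L) (fun V W => der V (α W) - der W (α V) - α (lie V W))
    (fun V V' W => by
      simp only [der_add_left, map_add, der_add, lie_add_left]; ring)
    (fun f V W => by
      simp only [der_smul_left, map_smul, map_sub, smul_eq_mul, der_mul, lie_smul_left]; ring)
    (fun V W W' => by
      simp only [der_add_left, map_add, der_add, lie_add_right]; ring)
    (fun f V W => by
      simp only [der_smul_left, map_smul, map_add, smul_eq_mul, der_mul, lie_smul_right]; ring)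

/-- The wedge product of two `1`-forms: `(α ∧ β)(V, W) = α(V) β(W) - α(W) β(V)`. -/
def wedge (α β : OneForm E L) : BilinForm E L :=
  LinearMap.mk₂ (SmoothFn E L) (fun V W => α V * β W - α W * β V)
    (fun V V' W => by simp only [map_add]; ring)
    (fun f V W => by simp only [map_smul, smul_eq_mul]; ring)
    (fun V W W' => by simp only [map_add]; ring)
    (fun f V W => by simp only [map_smul, smul_eq_mul]; ring)

/-- The Lie derivative of a `1`-form: `(ℒ_X α)(V) = X(α(V)) - α([X, V])`. -/
def lieForm (X : VField E L) (α : OneForm E L) : OneForm E L where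
  toFun V := der X (α V) - α (lie X V)
  map_add' V W := by simp only [map_add, der_add, lie_add_right]; ring
  map_smul' f V := by
    simp only [map_smul, smul_eq_mul, der_mul, lie_smul_right, map_add, RingHom.id_apply]; ring

/-- The bracket `{α, f} = ℒ_X α ∧ f - α ∧ ℒ_X f` of a `1`-form and a function. -/
def braceFn (X : VField E L) (α : OneForm E L) (f : SmoothFn E L) : OneForm E L :=
  f • lieForm X α - der X f • α

/-- The bracket `{α, β} = ℒ_X α ∧ β - α ∧ ℒ_X β` of two `1`-forms. -/
def braceForm (X : VField E L) (α β : OneForm E L) : BilinForm E L :=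
  wedge (lieForm X α) β - wedge α (lieForm X β)

end Forms

section Brackets

variable {G : Type*} [AddCommGroup G] [Module ℝ G]

/-- The Nijenhuis tensor of `J` with respect to a bracket `b`. -/
def nijenhuis (J : G → G) (b : G → G → G) (V W : G) : G :=
  b (J V) (J W) - b V W - J (b (J V) W) - J (b V (J W))

/-- `(∂̄W)(V)`, for the bracket `b`. -/
def dbarSection (J : G → G) (b : G → G → G) (W V : G) : G :=
  (1 / 2 : ℝ) • (b V W + J (b (J V) W)) + (1 / 4 : ℝ) • nijenhuis J b V W

/-- `(∂̄S)(V, W)` for a `1`-form `S` with values in `G`, for the bracket `b`. -/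
def dbarOneForm (J : G → G) (b : G → G → G) (S : G → G) (V W : G) : G :=
  dbarSection J b (S W) V - dbarSection J b (S V) W
    - (1 / 2 : ℝ) • S (b V W - b (J V) (J W))

/-- The quadratic expression `[S, S](V, W)`, for the bracket `b`. -/
def squareBracket (J : G → G) (b : G → G → G) (S : G → G) (V W : G) : G :=
  b (S V) (S W) - b (J (S V)) (J (S W))
    - S (b (S V) W + b V (S W) + J (b V (J (S W))) + J (b (J (S V)) W))
    - (1 / 2 : ℝ) • (S (nijenhuis J b (S V) W) + S (nijenhuis J b V (S W))
        - nijenhuis J b (S V) (S W))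

/-- The expression `[[S, S]](V, W)`, for the bracket `b`. -/
def doubleBracket (J : G → G) (b : G → G → G) (S : G → G) (V W : G) : G :=
  squareBracket J b S V W
    - (1 / 2 : ℝ) • S (nijenhuis J b V W - nijenhuis J b (S V) (S W))

end Brackets

section Cohomology

variable {M₀ M₁ M₂ : Type*} [AddCommMonoid M₀] [Module ℝ M₀] [AddCommGroup M₁] [Module ℝ M₁]
  [AddCommMonoid M₂] [Module ℝ M₂]

/-- The first cohomology space `ker d¹ / im d⁰` of `M₀ → M₁ → M₂`. -/
def H1 (d₀ : M₀ →ₗ[ℝ] M₁) (d₁ : M₁ →ₗ[ℝ] M₂) : Type _ :=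
  LinearMap.ker d₁ ⧸ (LinearMap.range d₀).submoduleOf (LinearMap.ker d₁)

instance (d₀ : M₀ →ₗ[ℝ] M₁) (d₁ : M₁ →ₗ[ℝ] M₂) : AddCommGroup (H1 d₀ d₁) :=
  inferInstanceAs (AddCommGroup (_ ⧸ (LinearMap.range d₀).submoduleOf (LinearMap.ker d₁)))

instance (d₀ : M₀ →ₗ[ℝ] M₁) (d₁ : M₁ →ₗ[ℝ] M₂) : Module ℝ (H1 d₀ d₁) :=
  inferInstanceAs (Module ℝ (_ ⧸ (LinearMap.range d₀).submoduleOf (LinearMap.ker d₁)))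

/-- The cohomology class of a cocycle. -/
def H1.mk (d₀ : M₀ →ₗ[ℝ] M₁) (d₁ : M₁ →ₗ[ℝ] M₂) (z : M₁) (hz : z ∈ LinearMap.ker d₁) :
    H1 d₀ d₁ :=
  Submodule.Quotient.mk ⟨z, hz⟩

/-- `z` is a cocycle whose cohomology class is `h`. -/
def H1.IsClassOf (d₀ : M₀ →ₗ[ℝ] M₁) (d₁ : M₁ →ₗ[ℝ] M₂) (z : M₁) (h : H1 d₀ d₁) : Prop :=
  ∃ hz : z ∈ LinearMap.ker d₁, H1.mk d₀ d₁ z hz = h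

end Cohomology

section LeviFlat

variable (E : Type*) [NormedAddCommGroup E] [NormedSpace ℝ E] [FiniteDimensional ℝ E]
  (L : Type*) [TopologicalSpace L] [ChartedSpace E L] [IsManifold 𝓘(ℝ, E) ∞ L]

variable {E L} in
/-- The vector fields tangent to a field `ξ` of subspaces of the tangent spaces. -/
def tangentFields (ξ : ∀ x : L, Submodule ℝ (TangentSpace 𝓘(ℝ, E) x)) :
    Submodule (SmoothFn E L) (VField E L) where
  carrier := {V | ∀ x, V x ∈ ξ x}
  add_mem' hV hW x := (ξ x).add_mem (hV x) (hW x)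
  zero_mem' x := (ξ x).zero_mem
  smul_mem' f _ hV x := (ξ x).smul_mem (f x) (hV x)

/-- An integrable distribution `ξ` of codimension `1` on `L`. Smoothness says that every vector of
`ξ` extends to a vector field tangent to `ξ`; integrability is involutivity. -/
structure Foliation where
  ξ : ∀ x : L, Submodule ℝ (TangentSpace 𝓘(ℝ, E) x)
  codim_one : ∀ x, Module.finrank ℝ (TangentSpace 𝓘(ℝ, E) x ⧸ ξ x) = 1
  smooth : ∀ x, ∀ v ∈ ξ x, ∃ V ∈ tangentFields ξ, V x = v
  involutive : ∀ V ∈ tangentFields ξ, ∀ W ∈ tangentFields ξ, lie V W ∈ tangentFields ξ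

variable {E L}

/-- The algebra `ℋ(ξ)` of vector fields tangent to `ξ`. -/
def Foliation.Sec (F : Foliation E L) : Type _ := tangentFields F.ξ

instance (F : Foliation E L) : AddCommGroup F.Sec :=
  inferInstanceAs (AddCommGroup (tangentFields F.ξ))

instance (F : Foliation E L) : Module (SmoothFn E L) F.Sec :=
  inferInstanceAs (Module (SmoothFn E L) (tangentFields F.ξ))

instance (F : Foliation E L) : Module ℝ F.Sec :=
  inferInstanceAs (Module ℝ (tangentFields F.ξ))

instance (F : Foliation E L) : IsScalarTower ℝ (SmoothFn E L) F.Sec :=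
  inferInstanceAs (IsScalarTower ℝ (SmoothFn E L) (tangentFields F.ξ))

theorem Foliation.Sec.coe_add {F : Foliation E L} (V W : F.Sec) : (V + W).1 = V.1 + W.1 := rfl

theorem Foliation.Sec.coe_neg {F : Foliation E L} (V : F.Sec) : (-V).1 = -V.1 := rfl

theorem Foliation.Sec.coe_smul {F : Foliation E L} (f : SmoothFn E L) (V : F.Sec) :
    (f • V).1 = f • V.1 := rfl

/-- The Lie bracket on `ℋ(ξ)`. -/
def Foliation.bracket (F : Foliation E L) (V W : F.Sec) : F.Sec :=
  ⟨lie V.1 W.1, F.involutive V.1 V.2 W.1 W.2⟩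

variable (E L) in
/-- A Levi flat structure `(ξ, J)` on `L`: an integrable distribution `ξ` of codimension `1` and a
smooth bundle endomorphism `J` of `ξ` with `J² = -1` (given by its `C^∞(L)`-linear action on
vector fields tangent to `ξ`) whose Nijenhuis tensor vanishes, i.e. which restricts to an
integrable complex structure on every leaf. -/
structure LeviFlatStructure extends Foliation E L where
  J : toFoliation.Sec →ₗ[SmoothFn E L] toFoliation.Sec
  J_sq : ∀ V, J (J V) = -V
  integrable : ∀ V W, nijenhuis J toFoliation.bracket V W = 0

/-- A DGLA defining couple `(γ, X)` for `ξ`: a `1`-form `γ` with kernel `ξ` and a vector field `X`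
with `γ(X) = 1`. -/
structure DefiningCouple (F : Foliation E L) where
  γ : OneForm E L
  X : VField E L
  ker_γ : ∀ V, γ V = 0 ↔ V ∈ tangentFields F.ξ
  γ_X : γ X = 1

section BracketRules

variable (F : Foliation E L)

theorem Foliation.bracket_add_left (V V' W : F.Sec) :
    F.bracket (V + V') W = F.bracket V W + F.bracket V' W :=
  Subtype.ext (lie_add_left V.1 V'.1 W.1)

theorem Foliation.bracket_add_right (V W W' : F.Sec) :
    F.bracket V (W + W') = F.bracket V W + F.bracket V W' :=
  Subtype.ext (lie_add_right V.1 W.1 W'.1)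

theorem Foliation.bracket_smul_left (f : SmoothFn E L) (V W : F.Sec) :
    F.bracket (f • V) W = f • F.bracket V W - der W.1 f • V :=
  Subtype.ext (lie_smul_left f V.1 W.1)

theorem Foliation.bracket_smul_right (V : F.Sec) (f : SmoothFn E L) (W : F.Sec) :
    F.bracket V (f • W) = f • F.bracket V W + der V.1 f • W :=
  Subtype.ext (lie_smul_right V.1 f W.1)

theorem Foliation.bracket_real_smul_right (V : F.Sec) (c : ℝ) (W : F.Sec) :
    F.bracket V (c • W) = c • F.bracket V W :=
  Subtype.ext (lie_real_smul_right V.1 c W.1)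

end BracketRules

namespace LeviFlatStructure

variable (F : LeviFlatStructure E L)

/-- The submodule of the `ξ`-valued `1`-forms on `ξ` which anticommute with `J`. -/
def antilinear : Submodule (SmoothFn E L) (F.Sec →ₗ[SmoothFn E L] F.Sec) where
  carrier := {P | ∀ V, P (F.J V) = -F.J (P V)}
  add_mem' hP hQ V := by simp only [LinearMap.add_apply, hP V, hQ V, map_add]; abel
  zero_mem' V := by simp
  smul_mem' f P hP V := by simp [hP V]

/-- `Λ^{0,1}_J(ξ) ⊗ ξ`: the `ξ`-valued `1`-forms on `ξ` which anticommute with `J`. -/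
def Form01 : Type _ := F.antilinear

instance : AddCommGroup F.Form01 := inferInstanceAs (AddCommGroup F.antilinear)

instance : Module (SmoothFn E L) F.Form01 := inferInstanceAs (Module (SmoothFn E L) F.antilinear)

instance : Module ℝ F.Form01 := inferInstanceAs (Module ℝ F.antilinear)

instance : IsScalarTower ℝ (SmoothFn E L) F.Form01 :=
  inferInstanceAs (IsScalarTower ℝ (SmoothFn E L) F.antilinear)

variable {F} in
theorem Form01.coe_add (P Q : F.Form01) : (P + Q).1 = P.1 + Q.1 := rfl

variable {F} in
theorem Form01.coe_smul (a : ℝ) (P : F.Form01) : (a • P).1 = a • P.1 := rfl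

/-- The target of `∂̄` on `Λ^{0,1}_J(ξ) ⊗ ξ`: bilinear maps on `ξ` with values in `ξ`. The values
of the operators below are alternating, i.e. `ξ`-valued `2`-forms on `ξ`. -/
abbrev Bilin := F.Sec →ₗ[SmoothFn E L] F.Sec →ₗ[SmoothFn E L] F.Sec

theorem J_real_smul (c : ℝ) (V : F.Sec) : F.J (c • V) = c • F.J V := by
  rw [algebra_compatible_smul (SmoothFn E L) c V, map_smul, algebraMap_smul]

theorem map_real_smul (P : F.Sec →ₗ[SmoothFn E L] F.Sec) (c : ℝ) (V : F.Sec) :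
    P (c • V) = c • P V := by
  rw [algebra_compatible_smul (SmoothFn E L) c V, map_smul, algebraMap_smul]

theorem dbarSection_eq (W V : F.Sec) : dbarSection F.J F.bracket W V =
    (1 / 2 : ℝ) • (F.bracket V W + F.J (F.bracket (F.J V) W)) := by
  rw [dbarSection, F.integrable, smul_zero, add_zero]

theorem dbarSection_add_left (W W' V : F.Sec) : dbarSection F.J F.bracket (W + W') V =
    dbarSection F.J F.bracket W V + dbarSection F.J F.bracket W' V := by
  simp only [dbarSection_eq, F.bracket_add_right, map_add]
  module

theorem dbarSection_add_right (W V V' : F.Sec) : dbarSection F.J F.bracket W (V + V') =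
    dbarSection F.J F.bracket W V + dbarSection F.J F.bracket W V' := by
  simp only [dbarSection_eq, F.bracket_add_left, map_add]
  module

theorem dbarSection_smul_right (f : SmoothFn E L) (W V : F.Sec) :
    dbarSection F.J F.bracket W (f • V) = f • dbarSection F.J F.bracket W V := by
  simp only [dbarSection_eq, F.bracket_smul_left, map_smul, map_sub, F.J_sq, smul_comm f (_ : ℝ)]
  congr 1
  module

theorem dbarSection_smul_left (f : SmoothFn E L) (W V : F.Sec) :
    dbarSection F.J F.bracket (f • W) V = f • dbarSection F.J F.bracket W V +
      (1 / 2 : ℝ) • (der V.1 f • W + der (F.J V).1 f • F.J W) := by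
  simp only [dbarSection_eq, F.bracket_smul_right, map_smul, map_add, smul_comm f (_ : ℝ)]
  rw [← smul_add]
  congr 1
  module

theorem dbarSection_real_smul (c : ℝ) (W V : F.Sec) :
    dbarSection F.J F.bracket (c • W) V = c • dbarSection F.J F.bracket W V := by
  simp only [dbarSection_eq, F.bracket_real_smul_right, J_real_smul]
  module

theorem dbarSection_J (W V : F.Sec) :
    dbarSection F.J F.bracket W (F.J V) = -F.J (dbarSection F.J F.bracket W V) := by
  have h : F.bracket (-V) W = -F.bracket V W := Subtype.ext (by
    have := lie_add_left (-V.1) V.1 W.1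
    have h0 : lie (0 : VField E L) W.1 = 0 := by simpa using lie_smul_left 0 0 W.1
    rw [neg_add_cancel, h0] at this
    exact eq_neg_of_add_eq_zero_left this.symm)
  simp only [dbarSection_eq, J_real_smul, map_add, F.J_sq, h, map_neg]
  module

/-- `∂̄ : Λ^{0,0}_J(ξ) ⊗ ξ → Λ^{0,1}_J(ξ) ⊗ ξ`. -/
def dbar₀ : F.Sec →ₗ[ℝ] F.Form01 where
  toFun W := ⟨{ toFun := fun V => dbarSection F.J F.bracket W V
                map_add' := F.dbarSection_add_right W
                map_smul' := fun f V => F.dbarSection_smul_right f W V }, F.dbarSection_J W⟩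
  map_add' W W' := Subtype.ext (LinearMap.ext fun V => F.dbarSection_add_left W W' V)
  map_smul' c W := Subtype.ext (LinearMap.ext fun V => F.dbarSection_real_smul c W V)

/-- `∂̄` on `Λ^{0,1}_J(ξ) ⊗ ξ`:
`∂̄P(V, W) = ∂̄(P(W))(V) - ∂̄(P(V))(W) - ½ P([V, W] - [JV, JW])`. -/
def dbar₁ : F.Form01 →ₗ[ℝ] F.Bilin where
  toFun P := LinearMap.mk₂ (SmoothFn E L) (dbarOneForm F.J F.bracket P.1)
    (fun V V' W => by
      simp only [dbarOneForm, map_add, dbarSection_add_left, dbarSection_add_right,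
        F.bracket_add_left, map_sub]
      module)
    (fun f V W => by
      have hP := P.2 V
      simp only [dbarOneForm, map_smul, dbarSection_smul_left, dbarSection_smul_right,
        F.bracket_smul_left, map_sub, smul_sub, hP, smul_comm f (_ : ℝ)]
      module)
    (fun V W W' => by
      simp only [dbarOneForm, map_add, dbarSection_add_left, dbarSection_add_right,
        F.bracket_add_right, map_sub]
      module)
    (fun f V W => by
      have hP := P.2 W
      simp only [dbarOneForm, map_smul, dbarSection_smul_left, dbarSection_smul_right,
        F.bracket_smul_right, map_sub, map_add, smul_sub, hP, smul_comm f (_ : ℝ)]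
      module)
  map_add' P Q := by
    refine LinearMap.ext₂ fun V W => ?_
    simp only [LinearMap.mk₂_apply, LinearMap.add_apply, dbarOneForm, Form01.coe_add,
      dbarSection_add_left]
    module
  map_smul' c P := by
    refine LinearMap.ext₂ fun V W => ?_
    simp only [LinearMap.mk₂_apply, LinearMap.smul_apply, dbarOneForm, RingHom.id_apply]
    simp only [Form01.coe_smul, LinearMap.smul_apply, dbarSection_real_smul]
    module

/-- `H¹(Λ^{0,*}_J(ξ) ⊗ ξ, ∂̄_J)`. -/
abbrev H1dbar := H1 F.dbar₀ F.dbar₁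

variable {F}

/-- `β^{0,1} ⊗ U`, where `β^{0,1}(V) = ½ (β(V) + i β(JV))` and `i` acts on `ξ` as `J`. -/
def tensor01 (β : OneForm E L) (U : F.Sec) : F.Form01 :=
  ⟨(1 / 2 : ℝ) • { toFun := fun V => β V.1 • U + β (F.J V).1 • F.J U
                   map_add' := fun V W => by
                    simp only [map_add, Foliation.Sec.coe_add]
                    module
                   map_smul' := fun f V => by
                    simp only [map_smul, Foliation.Sec.coe_smul, smul_eq_mul, RingHom.id_apply]
                    module },
    fun V => by
      simp only [LinearMap.smul_apply, LinearMap.coe_mk, AddHom.coe_mk, F.J_sq, J_real_smul,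
        Foliation.Sec.coe_neg, map_neg, map_add, map_smul]
      module⟩

/-- `(β^{0,1} ∧ P)(V, W) = β^{0,1}(V) P(W) - β^{0,1}(W) P(V)`, where `i` acts on `ξ` as `J`. -/
def wedge01 (β : OneForm E L) (P : F.Form01) : F.Bilin :=
  LinearMap.mk₂ (SmoothFn E L)
    (fun V W => (tensor01 β (P.1 W)).1 V - (tensor01 β (P.1 V)).1 W)
    (fun V V' W => by
      simp only [tensor01, LinearMap.smul_apply, LinearMap.coe_mk, AddHom.coe_mk, map_add]
      module)
    (fun f V W => by
      simp only [tensor01, LinearMap.smul_apply, LinearMap.coe_mk, AddHom.coe_mk, map_smul,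
        smul_sub, smul_comm f (_ : ℝ)]
      module)
    (fun V W W' => by
      simp only [tensor01, LinearMap.smul_apply, LinearMap.coe_mk, AddHom.coe_mk, map_add]
      module)
    (fun f V W => by
      simp only [tensor01, LinearMap.smul_apply, LinearMap.coe_mk, AddHom.coe_mk, map_smul,
        smul_sub, smul_comm f (_ : ℝ)]
      module)

end LeviFlatStructure

namespace DefiningCouple

variable {F : LeviFlatStructure E L} (c : DefiningCouple F.toFoliation)

/-- The submodule of the `1`-forms `α` with `ι_X α = 0`. -/
def horizontal : Submodule (SmoothFn E L) (OneForm E L) where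
  carrier := {α | α c.X = 0}
  add_mem' hα hβ := by
    simp only [Set.mem_ofPred_eq] at hα hβ ⊢
    simp [hα, hβ]
  zero_mem' := by simp
  smul_mem' f α hα := by
    simp only [Set.mem_ofPred_eq] at hα ⊢
    simp [hα]

/-- `𝒵¹(L)`: the `1`-forms `α` with `ι_X α = 0`. Note that `𝒵⁰(L) = C^∞(L)`. -/
def Z1 : Type _ := c.horizontal

instance : AddCommGroup c.Z1 := inferInstanceAs (AddCommGroup c.horizontal)

instance : Module ℝ c.Z1 := inferInstanceAs (Module ℝ c.horizontal)

variable {c} in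
theorem Z1.coe_add (α β : c.Z1) : (α + β).1 = α.1 + β.1 := rfl

variable {c} in
theorem Z1.coe_smul (a : ℝ) (α : c.Z1) : (a • α).1 = a • α.1 := rfl

theorem dFn_add_braceFn_mem (f : SmoothFn E L) : dFn f + braceFn c.X c.γ f ∈ c.horizontal := by
  change (dFn f + braceFn c.X c.γ f) c.X = 0
  simp [dFn, braceFn, lieForm, c.γ_X, lie_self, der_one]

/-- `δ = d + {γ, ·}` on `𝒵⁰(L) = C^∞(L)`. -/
def delta₀ : SmoothFn E L →ₗ[ℝ] c.Z1 where
  toFun f := ⟨dFn f + braceFn c.X c.γ f, c.dFn_add_braceFn_mem f⟩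
  map_add' f g := by
    refine Subtype.ext (LinearMap.ext fun V => ?_)
    change (dFn (f + g) + braceFn c.X c.γ (f + g)) V =
      (dFn f + braceFn c.X c.γ f) V + (dFn g + braceFn c.X c.γ g) V
    simp [dFn, braceFn, der_add]
    ring
  map_smul' a f := by
    refine Subtype.ext (LinearMap.ext fun V => ?_)
    change (dFn (a • f) + braceFn c.X c.γ (a • f)) V = a • (dFn f + braceFn c.X c.γ f) V
    simp only [dFn, braceFn, der_real_smul, LinearMap.add_apply, LinearMap.sub_apply,
      LinearMap.smul_apply, LinearMap.coe_mk, AddHom.coe_mk, smul_assoc]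
    module

/-- `δ = d + {γ, ·}` on `𝒵¹(L)`. -/
def delta₁ : c.Z1 →ₗ[ℝ] BilinForm E L where
  toFun α := dForm α.1 + braceForm c.X c.γ α.1
  map_add' α β := by
    refine LinearMap.ext₂ fun V W => ?_
    rw [Z1.coe_add]
    simp [dForm, braceForm, wedge, lieForm, der_add]
    ring
  map_smul' a α := by
    refine LinearMap.ext₂ fun V W => ?_
    simp only [dForm, braceForm, wedge, lieForm, der_real_smul, LinearMap.add_apply,
      LinearMap.sub_apply, LinearMap.smul_apply, LinearMap.mk₂_apply, LinearMap.coe_mk,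
      AddHom.coe_mk, RingHom.id_apply, Z1.coe_smul, mul_smul_comm,
      ← smul_sub, ← smul_add]

/-- `H¹(𝒵^*(L), δ)`. -/
abbrev H1delta := H1 c.delta₀ c.delta₁

/-- The projection `V ↦ V - γ(V) X` onto `ξ`. -/
def proj : VField E L →ₗ[SmoothFn E L] F.Sec where
  toFun V := ⟨V - c.γ V • c.X, (c.ker_γ _).1 (by simp [c.γ_X])⟩
  map_add' V W := Subtype.ext (by
    change V + W - c.γ (V + W) • c.X = (V - c.γ V • c.X) + (W - c.γ W • c.X)
    rw [map_add]; module)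
  map_smul' f V := Subtype.ext (by
    change f • V - c.γ (f • V) • c.X = f • (V - c.γ V • c.X)
    rw [map_smul, smul_eq_mul]; module)

theorem proj_coe (V : F.Sec) : c.proj V.1 = V :=
  Subtype.ext (by
    change V.1 - c.γ V.1 • c.X = V.1
    rw [(c.ker_γ V.1).2 V.2]; simp)

theorem proj_real_smul (a : ℝ) (V : VField E L) : c.proj (a • V) = a • c.proj V := by
  rw [algebra_compatible_smul (SmoothFn E L) a V, map_smul, algebraMap_smul]

/-- `T_Y(V) = [V, Y] - γ([V, Y]) X` for `V` tangent to `ξ`. -/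
def T (Y : VField E L) (V : F.Sec) : F.Sec := c.proj (lie V.1 Y)

theorem T_add (Y : VField E L) (V W : F.Sec) : c.T Y (V + W) = c.T Y V + c.T Y W := by
  rw [T, Foliation.Sec.coe_add, lie_add_left, map_add]; rfl

theorem T_smul (Y : VField E L) (f : SmoothFn E L) (V : F.Sec) :
    c.T Y (f • V) = f • c.T Y V - der Y f • V := by
  rw [T, Foliation.Sec.coe_smul, lie_smul_left, map_sub, map_smul, map_smul, proj_coe]; rfl

theorem T_neg (Y : VField E L) (V : F.Sec) : c.T Y (-V) = -c.T Y V := by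
  rw [eq_neg_iff_add_eq_zero, ← T_add, neg_add_cancel]
  simpa using c.T_smul Y 0 0

/-- The endomorphism `½ (T_Y + J T_Y J)` of `ξ`. -/
def HMap (Y : VField E L) : F.Sec →ₗ[SmoothFn E L] F.Sec where
  toFun V := (1 / 2 : ℝ) • (c.T Y V + F.J (c.T Y (F.J V)))
  map_add' V W := by
    simp only [T_add, map_add]
    module
  map_smul' f V := by
    simp only [T_smul, map_smul, map_sub, F.J_sq, RingHom.id_apply, smul_comm f (_ : ℝ)]
    module

theorem HMap_apply (Y : VField E L) (V : F.Sec) :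
    c.HMap Y V = (1 / 2 : ℝ) • (c.T Y V + F.J (c.T Y (F.J V))) := rfl

theorem HMap_mem (Y : VField E L) : c.HMap Y ∈ F.antilinear := fun V => by
  simp only [HMap_apply, F.J_sq, T_neg, F.J_real_smul, map_add, map_neg]
  module

/-- The form `H_Y(V) = ½ (T_Y(V) + J T_Y(JV))` in `Λ^{0,1}_J(ξ) ⊗ ξ`. -/
def HForm : VField E L →ₗ[ℝ] F.Form01 where
  toFun Y := ⟨c.HMap Y, c.HMap_mem Y⟩
  map_add' Y Y' := by
    refine Subtype.ext (LinearMap.ext fun V => ?_)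
    change c.HMap (Y + Y') V = c.HMap Y V + c.HMap Y' V
    simp only [HMap_apply, T, lie_add_right, map_add]
    module
  map_smul' a Y := by
    refine Subtype.ext (LinearMap.ext fun V => ?_)
    change c.HMap (a • Y) V = a • c.HMap Y V
    simp only [HMap_apply, T, lie_real_smul_right, proj_real_smul, F.J_real_smul]
    module

/-- The `(0,1)`-form `H = H_{J,γ,X}` associated to the couple `(γ, X)`. -/
def H : F.Form01 := c.HForm c.X

/-- The `1`-form `ι_X dγ`. -/
def iotaXdγ : OneForm E L := dForm c.γ c.X

/-- The operator `U ↦ ∂̄U - (ι_X dγ)^{0,1} ⊗ U` on `Λ^{0,0}_J(ξ) ⊗ ξ`. -/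
def beth₀ (U : F.Sec) : F.Form01 := F.dbar₀ U - LeviFlatStructure.tensor01 c.iotaXdγ U

/-- `ℨ¹(L, ξ) = 𝒵¹(L) ⊕ Λ^{0,1}_J(ξ) ⊗ ξ`. -/
abbrev Frak1 : Type _ := c.Z1 × F.Form01

/-- `𝔡⁰(φ, V) = (δφ, ∂̄V - φ H)`, on `ℨ⁰(L, ξ) = C^∞(L) ⊕ ℋ(ξ)`. -/
def frakd₀ : SmoothFn E L × F.Sec →ₗ[ℝ] c.Frak1 where
  toFun p := (c.delta₀ p.1, F.dbar₀ p.2 - p.1 • c.H)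
  map_add' p q := Prod.ext (map_add c.delta₀ p.1 q.1) (by
    simp only [Prod.snd_add, Prod.fst_add, map_add]
    module)
  map_smul' a p := Prod.ext (map_smul c.delta₀ a p.1) (by
    simp only [Prod.smul_snd, Prod.smul_fst, map_smul, RingHom.id_apply, smul_sub,
      smul_assoc])

theorem wedge01_add (α β : OneForm E L) (P : F.Form01) : LeviFlatStructure.wedge01 (α + β) P =
    LeviFlatStructure.wedge01 α P + LeviFlatStructure.wedge01 β P := by
  refine LinearMap.ext₂ fun V W => ?_
  simp [LeviFlatStructure.wedge01, LeviFlatStructure.tensor01]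
  module

theorem wedge01_smul (a : ℝ) (α : OneForm E L) (P : F.Form01) :
    LeviFlatStructure.wedge01 (a • α) P = a • LeviFlatStructure.wedge01 α P := by
  refine LinearMap.ext₂ fun V W => ?_
  simp [LeviFlatStructure.wedge01, LeviFlatStructure.tensor01]
  module

/-- `𝔡¹(α, P) = (δα, ∂̄P + α^{0,1} ∧ H)`. -/
def frakd₁ : c.Frak1 →ₗ[ℝ] BilinForm E L × F.Bilin where
  toFun p := (c.delta₁ p.1, F.dbar₁ p.2 + LeviFlatStructure.wedge01 p.1.1 c.H)
  map_add' p q := Prod.ext (map_add c.delta₁ p.1 q.1) (by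
    simp only [Prod.snd_add, Prod.fst_add, map_add, Z1.coe_add, wedge01_add]
    module)
  map_smul' a p := Prod.ext (map_smul c.delta₁ a p.1) (by
    simp only [Prod.smul_snd, Prod.smul_fst, map_smul,
      Z1.coe_smul, wedge01_smul, RingHom.id_apply, smul_add])

/-- `H¹(ℨ, 𝔡)`. -/
abbrev H1frak := H1 c.frakd₀ c.frakd₁

theorem mem_ker_frakd₁ (p : c.Frak1) : p ∈ LinearMap.ker c.frakd₁ ↔
    c.delta₁ p.1 = 0 ∧ F.dbar₁ p.2 = -LeviFlatStructure.wedge01 p.1.1 c.H := by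
  rw [LinearMap.mem_ker, eq_neg_iff_add_eq_zero]
  exact Prod.mk_eq_zero

/-- `𝒜`: the pairs `(β, P)` in `ℨ¹(L, ξ)` with `δβ = 0` and `∂̄P = -β^{0,1} ∧ H`. -/
def calA : Submodule ℝ c.Frak1 where
  carrier := {p | c.delta₁ p.1 = 0 ∧ F.dbar₁ p.2 = -LeviFlatStructure.wedge01 p.1.1 c.H}
  add_mem' {p q} hp hq :=
    (c.mem_ker_frakd₁ _).1 (add_mem ((c.mem_ker_frakd₁ p).2 hp) ((c.mem_ker_frakd₁ q).2 hq))
  zero_mem' := (c.mem_ker_frakd₁ _).1 (zero_mem _)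
  smul_mem' a p hp :=
    (c.mem_ker_frakd₁ _).1 (Submodule.smul_mem _ a ((c.mem_ker_frakd₁ p).2 hp))

/-- The relation `∼` on `𝒜`: `(β, P) ∼ (β', P')` if there is a vector field `Y` on `L` with
`β - β' = δ(γ(Y))` and `P - P' = -H_Y`. -/
def GaugeRel (p q : c.calA) : Prop :=
  ∃ Y : VField E L, p.1.1 - q.1.1 = c.delta₀ (c.γ Y) ∧ p.1.2 - q.1.2 = -c.HForm Y

theorem gaugeRel_zero (p : c.calA) : c.GaugeRel p 0 ↔
    ∃ Y : VField E L, p.1.1 = c.delta₀ (c.γ Y) ∧ p.1.2 = -c.HForm Y := by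
  unfold GaugeRel
  refine exists_congr fun Y => and_congr ?_ ?_
  · exact Eq.congr_left (sub_zero p.1.1)
  · exact Eq.congr_left (sub_zero p.1.2)

/-- The elements of `𝒜` which are equivalent to `0`. -/
def gaugeZero : Submodule ℝ c.calA where
  carrier := {p | c.GaugeRel p 0}
  add_mem' {p q} hp hq := by
    obtain ⟨Y, h1, h2⟩ := (c.gaugeRel_zero p).1 hp
    obtain ⟨Z, h3, h4⟩ := (c.gaugeRel_zero q).1 hq
    refine (c.gaugeRel_zero _).2 ⟨Y + Z, ?_, ?_⟩
    · rw [map_add, map_add, ← h1, ← h3]; rfl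
    · rw [map_add, neg_add, ← h2, ← h4]; rfl
  zero_mem' := by
    refine (c.gaugeRel_zero _).2 ⟨0, ?_, ?_⟩
    · rw [map_zero, map_zero]; rfl
    · rw [map_zero, neg_zero]; rfl
  smul_mem' a p hp := by
    obtain ⟨Y, h1, h2⟩ := (c.gaugeRel_zero p).1 hp
    refine (c.gaugeRel_zero _).2 ⟨a • Y, ?_, ?_⟩
    · rw [algebra_compatible_smul (SmoothFn E L) a Y, map_smul, algebraMap_smul, map_smul, ← h1]
      rfl
    · rw [map_smul]
      change a • p.1.2 = _
      rw [h2]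
      module

/-- `(β, P) ∼ (β', P')` if and only if they agree in the quotient of `𝒜` by `gaugeZero`. -/
theorem gaugeRel_iff (p q : c.calA) : c.GaugeRel p q ↔
    (Submodule.Quotient.mk p : c.calA ⧸ c.gaugeZero) = Submodule.Quotient.mk q := by
  rw [Submodule.Quotient.eq]
  exact (c.gaugeRel_zero (p - q)).symm

/-- The quotient `𝒜 / ∼`. -/
def Moduli := c.calA ⧸ c.gaugeZero

instance : AddCommGroup c.Moduli := inferInstanceAs (AddCommGroup (c.calA ⧸ c.gaugeZero))

instance : Module ℝ c.Moduli := inferInstanceAs (Module ℝ (c.calA ⧸ c.gaugeZero))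

/-- The class in `𝒜 / ∼` of an element of `𝒜`. -/
def modClass : c.calA →ₗ[ℝ] c.Moduli := c.gaugeZero.mkQ

theorem modClass_eq_iff (p q : c.calA) : c.modClass p = c.modClass q ↔ c.GaugeRel p q :=
  (c.gaugeRel_iff p q).symm

theorem modClass_surjective : Function.Surjective c.modClass :=
  c.gaugeZero.mkQ_surjective

/-- The class in `H¹(ℨ, 𝔡)` of an element of `𝒜`. -/
def frakClass (p : c.calA) : c.H1frak :=
  H1.mk c.frakd₀ c.frakd₁ p.1 ((c.mem_ker_frakd₁ p.1).2 p.2)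

/-- The bracket `[V, W]_α = ω_α⁻¹[ω_α(V), ω_α(W)]` on `ℋ(ξ)`, where `ω_α(V) = V - α(V) X`, so that
`ω_α⁻¹(V) = V + α(V) X`. If `ker(γ + α)` is integrable then `ω_α⁻¹[ω_α(V), ω_α(W)]` is tangent to
`ξ`, so that `proj` only records this fact. -/
def bracketOf (α : c.Z1) (V W : F.Sec) : F.Sec :=
  let Z := lie (V.1 - α.1 V.1 • c.X) (W.1 - α.1 W.1 • c.X)
  c.proj (Z + α.1 Z • c.X)

/-- The Maurer-Cartan set: `(α, S)` with `δα + ½ {α, α} = 0` and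
`∂̄^α S + ½ [[S, S]]_α = -α^{0,1} ∧ H`. -/
def MC : Set c.Frak1 :=
  {p | c.delta₁ p.1 + (1 / 2 : ℝ) • braceForm c.X p.1.1 p.1.1 = 0 ∧
    ∀ V W, dbarOneForm F.J (c.bracketOf p.1) p.2.1 V W
      + (1 / 2 : ℝ) • doubleBracket F.J (c.bracketOf p.1) p.2.1 V W
        = -LeviFlatStructure.wedge01 p.1.1 c.H V W}

/-- A smooth curve `[-a, a] → MC` through the origin. -/
structure IsMCCurve (a : ℝ) (lam : ℝ → c.Frak1) : Prop where
  pos : 0 < a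
  zero : lam 0 = 0
  mem : ∀ t ∈ Set.Icc (-a) a, lam t ∈ c.MC
  smooth_fst : ∀ V : VField E L, ContMDiffOn (𝓘(ℝ, ℝ).prod 𝓘(ℝ, E)) 𝓘(ℝ, ℝ) ∞
    (fun q : ℝ × L => (lam q.1).1.1 V q.2) (Set.Icc (-a) a ×ˢ Set.univ)
  smooth_snd : ∀ V : F.Sec, ContMDiffOn (𝓘(ℝ, ℝ).prod 𝓘(ℝ, E)) 𝓘(ℝ, E).tangent ∞
    (fun q : ℝ × L => (⟨q.2, ((lam q.1).2.1 V).1 q.2⟩ : TangentBundle 𝓘(ℝ, E) L))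
    (Set.Icc (-a) a ×ˢ Set.univ)

/-- `(β, P)` is the tangent vector at the origin of some smooth curve in `MC` through the origin. -/
def IsTangentVector (p : c.Frak1) : Prop :=
  ∃ (a : ℝ) (lam : ℝ → c.Frak1), c.IsMCCurve a lam ∧
    (∀ (V : VField E L) (x : L), HasDerivAt (fun t => (lam t).1.1 V x) (p.1.1 V x) 0) ∧
    (∀ (V : F.Sec) (x : L),
      HasDerivAt (fun t => (((lam t).2.1 V).1 x : TangentSpace 𝓘(ℝ, E) x)) ((p.2.1 V).1 x) 0)

/-- The infinitesimal deformations of `(ξ, J)`: the classes in `H¹(ℨ, 𝔡)` of the tangent vectors at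
the origin of curves in `MC`. -/
def infDeformations : Set c.H1frak :=
  {h | ∃ p : c.calA, c.IsTangentVector p.1 ∧ c.frakClass p = h}

end DefiningCouple

/-- A Levi flat structure is exact if `H_{J,γ,X} = 0` for some DGLA defining couple `(γ, X)`. -/
def LeviFlatStructure.IsExact (F : LeviFlatStructure E L) : Prop :=
  ∃ c : DefiningCouple F.toFoliation, c.H = 0

end LeviFlat

end

end LeviFlat

/-!
Let `U` satisfy `H = ∂̄U - (ι_X dγ)^{0,1} ⊗ U`. A `δ`-closed form `β` satisfies `dβ = β ∧ ι_X dγ`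
along the leaves, so the Leibniz rule gives `∂̄(β^{0,1} ⊗ U) = -β^{0,1} ∧ H`
(`dbar₁_tensor01_of_closed`). The substitution `(β, P) ↦ (β, P - β^{0,1} ⊗ U)` thus turns the
equations of `𝒜` into the uncoupled equations `δβ = 0` and `∂̄P = 0` (`mem_calA_iff`). Writing
`Y = φ X + W` with `W` tangent to `ξ` one has `H_Y = φ H + ∂̄W` (`HForm_eq`), and
`φ H + (δφ)^{0,1} ⊗ U = ∂̄(φU)`, so the same substitution turns the gauge relation into equality of
the two cohomology classes separately (`gaugeRel_zero_iff`). This is the isomorphism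
(`exists_moduli_equiv`). The formula for `H_Y` also shows that two elements of `𝒜` are gauge
equivalent exactly when they have the same class in `H¹(ℨ, 𝔡)` (`frakClass_eq_iff`), whence the
injection of the infinitesimal deformations. A couple with `H = 0` is the case `U = 0`. In general a
primitive `U` is obtained by comparing with a couple `(γ', X')` for which `H` vanishes: if
`γ' = g γ`, then `U` is `-g` times the projection of `X'` to `ξ` (`exists_eq_beth₀`).

That tangent vectors of Maurer-Cartan curves lie in `𝒜` is the linearization of the Maurer-Cartan
equations at the origin (`IsTangentVector.mem_calA`). The only analytic input is that time
derivatives commute with derivatives along vector fields (`SmoothFnCurve.der`), by the symmetry of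
second derivatives. Sections are handled through functions: they are determined by the derivatives
of functions along them (`VField.ext_der`), and a local frame of `ξ`, with coefficients of this
form (`Foliation.Frame`), expresses brackets and `C^∞(L)`-linear maps at a point by such
derivatives. Every term of the equations which is not linear in `(α, S)` is a sum of products of two
factors vanishing at time `0`; for the Nijenhuis terms this uses the integrability of `J`.
-/

namespace LeviFlat

noncomputable section

set_option linter.unusedSectionVars false

section Algebra

variable {E : Type*} [NormedAddCommGroup E] [NormedSpace ℝ E] [FiniteDimensional ℝ E]
  {L : Type*} [TopologicalSpace L] [ChartedSpace E L] [IsManifold 𝓘(ℝ, E) ∞ L]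

/-! ### The Dolbeault operators and products with `1`-forms -/

namespace LeviFlatStructure

variable {F : LeviFlatStructure E L}

theorem tensor01_apply (β : OneForm E L) (U V : F.Sec) :
    (tensor01 β U).1 V = (1 / 2 : ℝ) • (β V.1 • U + β (F.J V).1 • F.J U) := rfl

theorem wedge01_apply (β : OneForm E L) (P : F.Form01) (V W : F.Sec) :
    wedge01 β P V W = (tensor01 β (P.1 W)).1 V - (tensor01 β (P.1 V)).1 W := rfl

theorem dbar₀_apply (U V : F.Sec) :
    (F.dbar₀ U).1 V = (1 / 2 : ℝ) • (F.bracket V U + F.J (F.bracket (F.J V) U)) :=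
  F.dbarSection_eq U V

theorem real_smul_eq (a : ℝ) (V : F.Sec) : a • V = algebraMap ℝ (SmoothFn E L) a • V :=
  (algebraMap_smul _ a V).symm

/-- Lets `module` compare coefficients in the single ring `C^∞(L)`, where it does not evaluate the
images of real numerals. -/
theorem algebraMap_quarter : algebraMap ℝ (SmoothFn E L) (1 / 4) =
    algebraMap ℝ (SmoothFn E L) (1 / 2) * algebraMap ℝ (SmoothFn E L) (1 / 2) := by
  rw [← map_mul]; norm_num

theorem dbar₁_apply (P : F.Form01) (V W : F.Sec) :
    F.dbar₁ P V W = dbarSection F.J F.bracket (P.1 W) V - dbarSection F.J F.bracket (P.1 V) W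
      - (1 / 2 : ℝ) • P.1 (F.bracket V W - F.bracket (F.J V) (F.J W)) := rfl

theorem bracket_J_J (V W : F.Sec) : F.bracket (F.J V) (F.J W) =
    F.bracket V W + F.J (F.bracket (F.J V) W) + F.J (F.bracket V (F.J W)) := by
  have h := F.integrable V W
  rw [nijenhuis, sub_sub, sub_sub, sub_eq_zero] at h
  rw [h, add_assoc]

/-- `∂̄` commutes with `J`; this is where the vanishing of the Nijenhuis tensor enters. -/
theorem dbarSection_J_left (W V : F.Sec) : dbarSection F.J F.bracket (F.J W) V =
    F.J (dbarSection F.J F.bracket W V) := by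
  simp only [dbarSection_eq, bracket_J_J, map_add, F.J_sq, J_real_smul]
  module

theorem Form01.ext {P Q : F.Form01} (h : ∀ V, P.1 V = Q.1 V) : P = Q :=
  Subtype.ext (LinearMap.ext h)

theorem Form01.coe_sub (P Q : F.Form01) : (P - Q).1 = P.1 - Q.1 := rfl

theorem Form01.coe_neg (P : F.Form01) : (-P).1 = -P.1 := rfl

theorem Form01.coe_fn_smul (f : SmoothFn E L) (P : F.Form01) : (f • P).1 = f • P.1 := rfl

/-- The Leibniz rule `∂̄(fU) = f ∂̄U + (df)^{0,1} ⊗ U`. -/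
theorem dbar₀_fn_smul (f : SmoothFn E L) (U : F.Sec) :
    F.dbar₀ (f • U) = f • F.dbar₀ U + tensor01 (dFn f) U :=
  Form01.ext fun V => F.dbarSection_smul_left f U V

theorem tensor01_add_left (α β : OneForm E L) (U : F.Sec) :
    tensor01 (α + β) U = tensor01 α U + tensor01 β U := by
  refine Form01.ext fun V => ?_
  simp only [Form01.coe_add, LinearMap.add_apply, tensor01_apply]
  module

theorem tensor01_real_smul_left (a : ℝ) (β : OneForm E L) (U : F.Sec) :
    tensor01 (a • β) U = a • tensor01 β U := by
  refine Form01.ext fun V => ?_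
  simp only [Form01.coe_smul, LinearMap.smul_apply, tensor01_apply, smul_assoc]
  module

theorem tensor01_zero_right (β : OneForm E L) : tensor01 β (0 : F.Sec) = 0 := by
  refine Form01.ext fun V => ?_
  rw [tensor01_apply, map_zero, smul_zero, smul_zero, add_zero, smul_zero]
  rfl

theorem tensor01_smul_right (β : OneForm E L) (f : SmoothFn E L) (U : F.Sec) :
    tensor01 β (f • U) = f • tensor01 β U := by
  refine Form01.ext fun V => ?_
  simp only [Form01.coe_fn_smul, LinearMap.smul_apply, tensor01_apply, map_smul]
  module

/-- The Leibniz rule `∂̄(β^{0,1} ⊗ U) = (dβ)^{0,2} ⊗ U - β^{0,1} ∧ ∂̄U`. -/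
theorem dbar₁_tensor01 (β : OneForm E L) (U V W : F.Sec) :
    F.dbar₁ (tensor01 β U) V W = -wedge01 β (F.dbar₀ U) V W
      + (1 / 4 : ℝ) • ((dForm β V.1 W.1 - dForm β (F.J V).1 (F.J W).1) • U
        + (dForm β (F.J V).1 W.1 + dForm β V.1 (F.J W).1) • F.J U) := by
  have h : ∀ W V : F.Sec, (F.dbar₀ W).1 V = dbarSection F.J F.bracket W V := fun _ _ => rfl
  have d : ∀ V W : F.Sec, dForm β V.1 W.1 =
    der V.1 (β W.1) - der W.1 (β V.1) - β (F.bracket V W).1 := fun _ _ => rfl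
  have J1 : F.bracket V W - F.bracket (F.J V) (F.J W) =
      -(F.J (F.bracket (F.J V) W) + F.J (F.bracket V (F.J W))) := by
    rw [bracket_J_J]; abel
  have J2 : β (F.J (F.bracket (F.J V) W)).1 =
      β (F.bracket (F.J V) (F.J W)).1 - β (F.bracket V W).1
        - β (F.J (F.bracket V (F.J W))).1 := by
    rw [bracket_J_J]
    simp only [Foliation.Sec.coe_add, map_add]
    ring
  simp only [dbar₁_apply, tensor01_apply, J1, wedge01_apply,
    dbarSection_real_smul, dbarSection_add_left, dbarSection_smul_left, dbarSection_J_left, h,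
    map_neg, map_add, F.J_sq, Foliation.Sec.coe_neg, d, J2]
  simp only [real_smul_eq, algebraMap_quarter]
  module

end LeviFlatStructure

namespace DefiningCouple

variable {F : LeviFlatStructure E L} (c : DefiningCouple F.toFoliation)

open LeviFlatStructure

theorem γ_sec (V : F.Sec) : c.γ V.1 = 0 := (c.ker_γ V.1).2 V.2

theorem proj_X : c.proj c.X = 0 := Subtype.ext (by
  change c.X - c.γ c.X • c.X = 0
  rw [c.γ_X, one_smul, sub_self])

theorem eq_proj_add (Y : VField E L) : Y = (c.proj Y).1 + c.γ Y • c.X :=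
  (sub_add_cancel Y (c.γ Y • c.X)).symm

theorem iotaXdγ_sec (V : F.Sec) : c.iotaXdγ V.1 = -c.γ (lie c.X V.1) := by
  change der c.X (c.γ V.1) - der V.1 (c.γ c.X) - c.γ (lie c.X V.1) = _
  have h : der c.X (0 : SmoothFn E L) = 0 := by simpa using der_algebraMap c.X 0
  rw [γ_sec, γ_X, der_one, h]
  ring

theorem lieForm_γ_sec (V : F.Sec) : lieForm c.X c.γ V.1 = c.iotaXdγ V.1 := by
  rw [iotaXdγ_sec]
  change der c.X (c.γ V.1) - c.γ (lie c.X V.1) = _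
  have h : der c.X (0 : SmoothFn E L) = 0 := by simpa using der_algebraMap c.X 0
  rw [γ_sec, h, zero_sub]

/-- A `δ`-closed form satisfies `dβ = β ∧ ι_X dγ` along the leaves. -/
theorem dForm_sec {β : c.Z1} (hβ : c.delta₁ β = 0) (V W : F.Sec) :
    dForm β.1 V.1 W.1 = β.1 V.1 * c.iotaXdγ W.1 - β.1 W.1 * c.iotaXdγ V.1 := by
  have h : dForm β.1 V.1 W.1 + ((lieForm c.X c.γ V.1 * β.1 W.1 - lieForm c.X c.γ W.1 * β.1 V.1)
      - (c.γ V.1 * lieForm c.X β.1 W.1 - c.γ W.1 * lieForm c.X β.1 V.1)) = 0 :=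
    congrArg (fun B : BilinForm E L => B V.1 W.1) hβ
  rw [lieForm_γ_sec, lieForm_γ_sec, γ_sec, γ_sec] at h
  linear_combination h

/-- Along the leaves, `δφ = dφ + φ ι_X dγ`. -/
theorem delta₀_sec (φ : SmoothFn E L) (V : F.Sec) :
    (c.delta₀ φ).1 V.1 = der V.1 φ + φ * c.iotaXdγ V.1 := by
  change der V.1 φ + (φ * lieForm c.X c.γ V.1 - der c.X φ * c.γ V.1) = _
  rw [lieForm_γ_sec, γ_sec]
  ring

/-- On `δ`-closed forms the curvature term `(dβ)^{0,2} ⊗ U` is absorbed by twisting `∂̄`. -/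
theorem dbar₁_tensor01_of_closed {β : c.Z1} (hβ : c.delta₁ β = 0) (U : F.Sec) :
    F.dbar₁ (tensor01 β.1 U) = -wedge01 β.1 (c.beth₀ U) := by
  refine LinearMap.ext₂ fun V W => ?_
  rw [dbar₁_tensor01]
  simp only [LinearMap.neg_apply, wedge01_apply, beth₀, Form01.coe_sub, LinearMap.sub_apply,
    tensor01_apply, c.dForm_sec hβ, map_add, map_sub, map_smul, J_real_smul, F.J_sq]
  simp only [real_smul_eq, algebraMap_quarter]
  module

/-! ### Splitting the gauge relation -/

/-- `H_Y = φ H + ∂̄W` for `Y = φ X + W` with `W` tangent to `ξ`. -/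
theorem HForm_eq (Y : VField E L) : c.HForm Y = c.γ Y • c.H + F.dbar₀ (c.proj Y) := by
  have hT : ∀ V : F.Sec, c.T Y V = c.γ Y • c.T c.X V + F.bracket V (c.proj Y) := by
    intro V
    conv_lhs => rw [T, c.eq_proj_add Y]
    rw [lie_add_right, lie_smul_right, map_add, map_add, map_smul, map_smul, proj_X, smul_zero,
      add_zero, add_comm]
    congr 1
    exact c.proj_coe (F.bracket V (c.proj Y))
  refine Form01.ext fun V => ?_
  change c.HMap Y V = c.γ Y • c.HMap c.X V + (F.dbar₀ (c.proj Y)).1 V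
  simp only [HMap_apply, dbar₀_apply, hT, map_add, map_smul]
  module

/-- If `H = ∂̄U - (ι_X dγ)^{0,1} ⊗ U` then `φ H + (δφ)^{0,1} ⊗ U = ∂̄(φU)`. -/
theorem smul_H_add_tensor01 {U : F.Sec} (hU : c.H = c.beth₀ U) (φ : SmoothFn E L) :
    φ • c.H + tensor01 (c.delta₀ φ).1 U = F.dbar₀ (φ • U) := by
  have h : tensor01 (c.delta₀ φ).1 U = tensor01 (dFn φ) U + φ • tensor01 c.iotaXdγ U := by
    refine Form01.ext fun V => ?_
    simp only [Form01.coe_add, LinearMap.add_apply, Form01.coe_fn_smul, LinearMap.smul_apply,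
      tensor01_apply, delta₀_sec]
    change _ = (1 / 2 : ℝ) • (der V.1 φ • U + der (F.J V).1 φ • F.J U) + _
    module
  rw [hU, beth₀, h, dbar₀_fn_smul]
  module

/-- The linear map `(β, P) ↦ P - β^{0,1} ⊗ U`. -/
def untwist (U : F.Sec) : c.Frak1 →ₗ[ℝ] F.Form01 where
  toFun p := p.2 - tensor01 p.1.1 U
  map_add' p q := by
    simp only [Prod.snd_add, Prod.fst_add, Z1.coe_add, tensor01_add_left]
    module
  map_smul' a p := by
    simp only [Prod.smul_snd, Prod.smul_fst, Z1.coe_smul, tensor01_real_smul_left,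
      RingHom.id_apply, smul_sub]

theorem untwist_apply (U : F.Sec) (p : c.Frak1) : c.untwist U p = p.2 - tensor01 p.1.1 U := rfl

/-- `(β, P) ↦ (β, P - β^{0,1} ⊗ U)` turns the equations defining `𝒜` into two uncoupled ones. -/
theorem mem_calA_iff {U : F.Sec} (hU : c.H = c.beth₀ U) (p : c.Frak1) :
    p ∈ c.calA ↔ c.delta₁ p.1 = 0 ∧ F.dbar₁ (c.untwist U p) = 0 := by
  refine and_congr_right fun h => ?_
  rw [untwist_apply, map_sub, c.dbar₁_tensor01_of_closed h, ← hU, sub_neg_eq_add,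
    add_eq_zero_iff_eq_neg]

/-- The substitution `(β, P) ↦ (β, P - β^{0,1} ⊗ U)` also uncouples the gauge relation. -/
theorem gaugeRel_zero_iff {U : F.Sec} (hU : c.H = c.beth₀ U) (p : c.calA) :
    c.GaugeRel p 0 ↔ (∃ φ, c.delta₀ φ = p.1.1) ∧ ∃ W, F.dbar₀ W = c.untwist U p.1 := by
  rw [gaugeRel_zero]
  constructor
  · rintro ⟨Y, h1, h2⟩
    refine ⟨⟨_, h1.symm⟩, -(c.proj Y + c.γ Y • U), ?_⟩
    rw [untwist_apply, h1, h2, HForm_eq, map_neg, map_add, ← c.smul_H_add_tensor01 hU]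
    abel
  · rintro ⟨⟨φ, h1⟩, W, h2⟩
    -- the gauge field is `Y = φ X - (W + φ U)`
    have hγ : c.γ (φ • c.X + (-(W + φ • U)).1) = φ := by
      rw [map_add, map_smul, γ_X, γ_sec, add_zero, smul_eq_mul, mul_one]
    have hp : c.proj (φ • c.X + (-(W + φ • U)).1) = -(W + φ • U) := by
      rw [map_add, map_smul, proj_X, smul_zero, zero_add, proj_coe]
    refine ⟨φ • c.X + (-(W + φ • U)).1, ?_, ?_⟩
    · rw [hγ, h1]
    · rw [HForm_eq, hγ, hp, map_neg, map_add, ← c.smul_H_add_tensor01 hU, h2, untwist_apply, ← h1]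
      abel

/-- `𝒜 / ∼` is the quotient of `𝒜` by the coboundaries of `𝔡`, i.e. `H¹(ℨ, 𝔡)`. -/
theorem frakClass_eq_iff (p q : c.calA) :
    c.frakClass p = c.frakClass q ↔ c.modClass p = c.modClass q := by
  rw [modClass_eq_iff, frakClass, frakClass, H1.mk, H1.mk]
  refine (Submodule.Quotient.eq _).trans ?_
  change p.1 - q.1 ∈ LinearMap.range c.frakd₀ ↔ _
  constructor
  · rintro ⟨⟨φ, W⟩, h⟩
    have h1 : c.delta₀ φ = p.1.1 - q.1.1 := congrArg Prod.fst h
    have h2 : F.dbar₀ W - φ • c.H = p.1.2 - q.1.2 := congrArg Prod.snd h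
    have hγ : c.γ (φ • c.X + (-W).1) = φ := by
      rw [map_add, map_smul, γ_X, γ_sec, add_zero, smul_eq_mul, mul_one]
    have hp : c.proj (φ • c.X + (-W).1) = -W := by
      rw [map_add, map_smul, proj_X, smul_zero, zero_add, proj_coe]
    refine ⟨φ • c.X + (-W).1, ?_, ?_⟩
    · rw [hγ, h1]
    · rw [HForm_eq, hγ, hp, map_neg, ← h2]
      abel
  · rintro ⟨Y, h1, h2⟩
    refine ⟨(c.γ Y, -c.proj Y), Prod.ext h1.symm ?_⟩
    change F.dbar₀ (-c.proj Y) - c.γ Y • c.H = p.1.2 - q.1.2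
    rw [h2, HForm_eq, map_neg]
    abel

/-! ### Change of the defining couple -/

/-- If one couple has vanishing `H`, then the form `H` of any couple is `∂̄U - (ι_X dγ)^{0,1} ⊗ U`
for some `U`. -/
theorem exists_eq_beth₀ (c' : DefiningCouple F.toFoliation) (h' : c'.H = 0) :
    ∃ U : F.Sec, c.H = c.beth₀ U := by
  -- `γ' = g γ` and `X' = h X + W` with `g h = 1`; the section sought is `-g W`
  let g := c'.γ c.X
  let h := c.γ c'.X
  let W : F.Sec := c.proj c'.X
  have hX : c'.X = W.1 + h • c.X := c.eq_proj_add c'.X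
  have hgh : g * h = 1 := by
    have := c'.γ_X
    rw [hX, map_add, map_smul, γ_sec, zero_add, smul_eq_mul] at this
    rw [mul_comm]; exact this
  have hpX : c'.proj c.X = -(g • W) := by
    have h0 := c'.proj_X
    rw [hX, map_add, map_smul, proj_coe] at h0
    have : g • (W + h • c'.proj c.X) = 0 := by rw [h0, smul_zero]
    rw [smul_add, smul_smul, hgh, one_smul, add_comm] at this
    exact eq_neg_of_add_eq_zero_left this
  have hp : ∀ Z : VField E L, c'.proj Z = c.proj Z - c.γ Z • g • W := by
    intro Z
    conv_lhs => rw [c.eq_proj_add Z]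
    rw [map_add, map_smul, proj_coe, hpX]
    module
  have hι : ∀ V : F.Sec, c.γ (lie V.1 c.X) = c.iotaXdγ V.1 := by
    intro V
    rw [iotaXdγ_sec, lie_swap, map_neg]
  have hT : ∀ V : F.Sec, c'.T c'.X V = h • c.T c.X V + F.bracket V W
      - (h * c.iotaXdγ V.1 + der V.1 h) • g • W := by
    intro V
    have e : lie V.1 c'.X = (F.bracket V W).1 + (h • lie V.1 c.X + der V.1 h • c.X) := by
      rw [hX, lie_add_right, lie_smul_right]; rfl
    rw [T, hp, e]
    simp only [map_add, map_smul, proj_coe, proj_X, γ_sec, γ_X, hι, T, smul_eq_mul]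
    module
  -- differentiate `g h = 1`
  have hd : ∀ V : F.Sec, g * g * der V.1 h = -der V.1 g := by
    intro V
    have h1 := der_mul V.1 g h
    rw [hgh, der_one] at h1
    linear_combination (-g) * h1 - der V.1 g * hgh
  refine ⟨-(g • W), Form01.ext fun V => ?_⟩
  have h0 : (1 / 2 : ℝ) • (c'.T c'.X V + F.J (c'.T c'.X (F.J V))) = 0 :=
    congrArg (fun P : F.Form01 => P.1 V) h'
  have h1 : g • (1 / 2 : ℝ) • (c'.T c'.X V + F.J (c'.T c'.X (F.J V))) = 0 := by
    rw [h0, smul_zero]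
  rw [← smul_neg, beth₀, dbar₀_fn_smul, tensor01_smul_right]
  change (1 / 2 : ℝ) • (c.T c.X V + F.J (c.T c.X (F.J V))) = _
  simp only [Form01.coe_sub, Form01.coe_add, Form01.coe_fn_smul, LinearMap.sub_apply,
    LinearMap.add_apply, LinearMap.smul_apply, tensor01_apply, map_neg, Form01.coe_neg,
    LinearMap.neg_apply, dbar₀_apply]
  change _ = _ + (1 / 2 : ℝ) • (der V.1 g • -W + der (F.J V).1 g • -F.J W) - _
  -- multiplying by `g h = 1` and substituting for `dg` leaves an identity in free coefficients
  have e1 : ∀ Z : F.Sec, Z = (g * h) • Z := fun Z => by rw [hgh, one_smul]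
  have e2 : ∀ V : F.Sec, der V.1 g = -(g * g * der V.1 h) := fun V => by rw [hd, neg_neg]
  rw [e2 V, e2 (F.J V), e1 ((1 / 2 : ℝ) • (c.T c.X V + F.J (c.T c.X (F.J V)))),
    e1 (c.iotaXdγ V.1 • -W), e1 (c.iotaXdγ (F.J V).1 • -F.J W), ← sub_eq_zero, ← h1, hT, hT]
  simp only [map_add, map_sub, map_smul]
  module

/-! ### The isomorphism with the product of the cohomology spaces -/

/-- The isomorphism of `𝒜 / ∼` with `H¹(𝒵, δ) × H¹(∂̄)` given by a primitive `U` of `H`, and its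
restriction to infinitesimal deformations. -/
theorem exists_moduli_equiv {U : F.Sec} (hU : c.H = c.beth₀ U) :
    ∃ Φ : c.Moduli ≃ₗ[ℝ] c.H1delta × F.H1dbar,
      (∀ z : c.calA, H1.IsClassOf c.delta₀ c.delta₁ z.1.1 (Φ (c.modClass z)).1 ∧
        H1.IsClassOf F.dbar₀ F.dbar₁ (c.untwist U z.1) (Φ (c.modClass z)).2) ∧
      ∃ ι : c.infDeformations → c.H1delta × F.H1dbar, Function.Injective ι ∧
        ∀ (h : c.infDeformations) (z : c.calA), c.frakClass z = h →
          ι h = Φ (c.modClass z) := by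
  let B₁ := (LinearMap.range c.delta₀).submoduleOf (LinearMap.ker c.delta₁)
  let B₂ := (LinearMap.range F.dbar₀).submoduleOf (LinearMap.ker F.dbar₁)
  let f₁ : c.calA →ₗ[ℝ] LinearMap.ker c.delta₁ :=
    (LinearMap.fst ℝ c.Z1 F.Form01 ∘ₗ c.calA.subtype).codRestrict _
      fun z => ((c.mem_calA_iff hU z.1).1 z.2).1
  let f₂ : c.calA →ₗ[ℝ] LinearMap.ker F.dbar₁ :=
    (c.untwist U ∘ₗ c.calA.subtype).codRestrict _ fun z => ((c.mem_calA_iff hU z.1).1 z.2).2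
  let Ψ : c.calA →ₗ[ℝ] c.H1delta × F.H1dbar :=
    LinearMap.prod (B₁.mkQ ∘ₗ f₁ : c.calA →ₗ[ℝ] c.H1delta) (B₂.mkQ ∘ₗ f₂ : c.calA →ₗ[ℝ] F.H1dbar)
  have hker : LinearMap.ker Ψ = c.gaugeZero := by
    ext z
    refine Iff.trans ?_ (c.gaugeRel_zero_iff hU z).symm
    rw [LinearMap.mem_ker]
    refine Prod.mk_eq_zero.trans (and_congr ?_ ?_)
    · exact Submodule.Quotient.mk_eq_zero B₁
    · exact Submodule.Quotient.mk_eq_zero B₂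
  have hsurj : Function.Surjective Ψ := by
    rintro ⟨a, b⟩
    obtain ⟨⟨α, hα⟩, rfl⟩ := B₁.mkQ_surjective a
    obtain ⟨⟨Q, hQ⟩, rfl⟩ := B₂.mkQ_surjective b
    have hu : c.untwist U (α, Q + tensor01 α.1 U) = Q := by
      rw [untwist_apply, add_sub_cancel_right]
    refine ⟨⟨(α, Q + tensor01 α.1 U), (c.mem_calA_iff hU _).2 ⟨hα, ?_⟩⟩, Prod.ext rfl ?_⟩
    · rw [hu]; exact hQ
    · exact congrArg B₂.mkQ (Subtype.ext hu)
  let Φ : c.Moduli ≃ₗ[ℝ] c.H1delta × F.H1dbar :=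
    (Submodule.quotEquivOfEq _ _ hker.symm).trans (Ψ.quotKerEquivOfSurjective hsurj)
  have hΦ : ∀ z, Φ (c.modClass z) = Ψ z := fun z => rfl
  refine ⟨Φ, fun z => ⟨⟨(f₁ z).2, rfl⟩, ⟨(f₂ z).2, rfl⟩⟩,
    fun h => Φ (c.modClass h.2.choose), fun h h' e => ?_, fun h z e => ?_⟩
  · have e' := (c.frakClass_eq_iff _ _).2 (Φ.injective e)
    rw [h.2.choose_spec.2, h'.2.choose_spec.2] at e'
    exact Subtype.ext e'
  · refine congrArg Φ ((c.frakClass_eq_iff _ _).1 ?_)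
    rw [h.2.choose_spec.2, e]

end DefiningCouple

end Algebra

section Curves

open Filter Topology

/-! ### First-order calculus of curves of functions and sections -/

/-- Symmetry of second derivatives: for a `C²` function `G(t, y)` the `t`-derivative of `∂G/∂y` is
the `y`-derivative of `∂G/∂t`. -/
theorem hasDerivAt_fderiv_of_contDiffAt {E : Type*} [NormedAddCommGroup E] [NormedSpace ℝ E]
    {G : ℝ × E → ℝ} {g : E → ℝ} {y : E} (hG : ContDiffAt ℝ 2 G (0, y))
    (hg : ∀ᶠ z in 𝓝 y, HasDerivAt (fun t => G (t, z)) (g z) 0) (v : E) :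
    HasDerivAt (fun t => fderiv ℝ (fun z => G (t, z)) y v) (fderiv ℝ g y v) 0 := by
  have hd : ∀ᶠ q in 𝓝 ((0 : ℝ), y), DifferentiableAt ℝ G q :=
    (hG.eventually (by simp)).mono fun q hq => hq.differentiableAt (by simp)
  have hD : DifferentiableAt ℝ (fderiv ℝ G) (0, y) :=
    (hG.fderiv_right (m := 1) (by norm_num)).differentiableAt (by simp)
  have c₁ : HasDerivAt (fun t : ℝ => (t, y)) ((1 : ℝ), (0 : E)) 0 :=
    (hasDerivAt_id 0).prodMk (hasDerivAt_const 0 y)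
  have c₂ : ∀ (t : ℝ) (z : E), HasFDerivAt (fun z : E => (t, z))
      (ContinuousLinearMap.inr ℝ ℝ E) z := fun t z => hasFDerivAt_prodMk_right t z
  have h₁ : HasDerivAt (fun t => fderiv ℝ G (t, y) (0, v))
      (fderiv ℝ (fderiv ℝ G) (0, y) (1, 0) (0, v)) 0 := by
    have := hD.hasFDerivAt.comp_hasDerivAt (0 : ℝ) c₁
    exact this.clm_apply (hasDerivAt_const 0 ((0 : ℝ), v)) |>.congr_deriv (by simp)
  have e₁ : (fun t => fderiv ℝ (fun z => G (t, z)) y v) =ᶠ[𝓝 0]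
      fun t => fderiv ℝ G (t, y) (0, v) := by
    filter_upwards [c₁.continuousAt.eventually hd] with t ht
    have : fderiv ℝ (fun z => G (t, z)) y = _ := (ht.hasFDerivAt.comp y (c₂ t y)).fderiv
    rw [this]
    simp
  have e₂ : g =ᶠ[𝓝 y] fun z => fderiv ℝ G (0, z) (1, 0) := by
    filter_upwards [(c₂ 0 y).continuousAt.eventually hd, hg] with z hz hgz
    have : HasDerivAt (fun t : ℝ => (t, z)) ((1 : ℝ), (0 : E)) 0 :=
      (hasDerivAt_id 0).prodMk (hasDerivAt_const 0 z)
    exact hgz.unique (hz.hasFDerivAt.comp_hasDerivAt (0 : ℝ) this)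
  have h₂ : fderiv ℝ g y v = fderiv ℝ (fderiv ℝ G) (0, y) (0, v) (1, 0) := by
    rw [e₂.fderiv_eq]
    have h := (hD.hasFDerivAt.comp y (c₂ 0 y)).clm_apply (hasFDerivAt_const ((1 : ℝ), (0 : E)) y)
    have : fderiv ℝ (fun z => fderiv ℝ G (0, z) (1, 0)) y = _ := h.fderiv
    rw [this]
    simp
  rw [h₂, (hG.isSymmSndFDerivAt (by simp)).eq (0, v) (1, 0)]
  exact h₁.congr_of_eventuallyEq e₁

variable {E : Type*} [NormedAddCommGroup E] [NormedSpace ℝ E] [FiniteDimensional ℝ E]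
  {L : Type*} [TopologicalSpace L] [ChartedSpace E L] [IsManifold 𝓘(ℝ, E) ∞ L]

/-- `A_t(x)` vanishes at `t = 0`, with derivative `A'(x)`. -/
def FnTangentAt (x : L) (A : ℝ → SmoothFn E L) (A' : SmoothFn E L) : Prop :=
  A 0 x = 0 ∧ HasDerivAt (fun t => A t x) (A' x) 0

/-- `V_t(x)` vanishes at `t = 0`, with derivative `V'(x)`. This is tested on the derivatives of
functions along `V_t`, so as to deal with real-valued maps only. -/
def FieldTangentAt (x : L) (V : ℝ → VField E L) (V' : VField E L) : Prop :=
  ∀ ψ : SmoothFn E L, FnTangentAt x (fun t => der (V t) ψ) (der V' ψ)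

/-- A curve of functions through `0`, jointly smooth near time `0`, with derivative `A'` at `0`. -/
structure SmoothFnCurve (A : ℝ → SmoothFn E L) (A' : SmoothFn E L) : Prop where
  tangentAt : ∀ x, FnTangentAt x A A'
  smooth : ∀ x : L, ContMDiffAt (𝓘(ℝ, ℝ).prod 𝓘(ℝ, E)) 𝓘(ℝ, ℝ) ∞
    (fun q : ℝ × L => A q.1 q.2) (0, x)

/-- A curve of vector fields through `0`, smooth in the sense that it gives smooth curves of
functions when applied to functions. -/
def SmoothFieldCurve (V : ℝ → VField E L) (V' : VField E L) : Prop :=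
  ∀ ψ : SmoothFn E L, SmoothFnCurve (fun t => der (V t) ψ) (der V' ψ)

theorem SmoothFieldCurve.tangentAt {V : ℝ → VField E L} {V' : VField E L}
    (h : SmoothFieldCurve V V') (x : L) : FieldTangentAt x V V' := fun ψ => (h ψ).tangentAt x

theorem der_zero_left (ψ : SmoothFn E L) : der (0 : VField E L) ψ = 0 := by
  simpa using der_smul_left 0 (0 : VField E L) ψ

theorem der_zero_right (V : VField E L) : der V (0 : SmoothFn E L) = 0 := by
  simpa using der_algebraMap V 0

theorem der_neg_left (V : VField E L) (ψ : SmoothFn E L) : der (-V) ψ = -der V ψ := by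
  rw [← neg_one_smul (SmoothFn E L) V, der_smul_left, neg_one_mul]

namespace FnTangentAt

variable {x : L} {A B : ℝ → SmoothFn E L} {A' B' : SmoothFn E L}

theorem add (hA : FnTangentAt x A A') (hB : FnTangentAt x B B') :
    FnTangentAt x (fun t => A t + B t) (A' + B') :=
  ⟨by simp [hA.1, hB.1], hA.2.add hB.2⟩

theorem neg (hA : FnTangentAt x A A') : FnTangentAt x (fun t => -A t) (-A') :=
  ⟨by simp [hA.1], hA.2.neg⟩

theorem sub (hA : FnTangentAt x A A') (hB : FnTangentAt x B B') :
    FnTangentAt x (fun t => A t - B t) (A' - B') :=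
  ⟨by simp [hA.1, hB.1], hA.2.sub hB.2⟩

theorem fn_mul (f : SmoothFn E L) (hA : FnTangentAt x A A') :
    FnTangentAt x (fun t => f * A t) (f * A') :=
  ⟨by simp [hA.1], hA.2.const_mul (f x)⟩

/-- A product of curves through zero vanishes to second order. -/
theorem mul (hA : FnTangentAt x A A') (hB : FnTangentAt x B B') :
    FnTangentAt x (fun t => A t * B t) 0 :=
  ⟨by simp [hA.1], (hA.2.mul hB.2).congr_deriv (by simp [hA.1, hB.1])⟩

theorem zero : FnTangentAt x (fun _ => (0 : SmoothFn E L)) 0 :=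
  ⟨rfl, hasDerivAt_const 0 0⟩

theorem sum {ι : Type*} (s : Finset ι) {A : ι → ℝ → SmoothFn E L} {A' : ι → SmoothFn E L}
    (h : ∀ i, FnTangentAt x (A i) (A' i)) :
    FnTangentAt x (fun t => ∑ i ∈ s, A i t) (∑ i ∈ s, A' i) := by
  classical
  induction s using Finset.induction_on with
  | empty => simpa using zero
  | insert i s hi ih => simpa [Finset.sum_insert hi] using (h i).add ih

/-- Only the values at `x` matter. -/
theorem congr (hA : FnTangentAt x A A') (h : ∀ t, B t x = A t x) (h' : A' x = B' x) :
    FnTangentAt x B B' := by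
  refine ⟨by rw [h, hA.1], ?_⟩
  rw [← h']
  simpa only [h] using hA.2

theorem unique (hA : FnTangentAt x A A') (hB : FnTangentAt x B B')
    (h : ∀ᶠ t in 𝓝 0, A t x = B t x) : A' x = B' x :=
  (hA.2.congr_of_eventuallyEq (EventuallyEq.symm h)).unique hB.2

end FnTangentAt

/-- Time derivatives at `0` commute with the derivative along a fixed vector field. -/
theorem SmoothFnCurve.der {A : ℝ → SmoothFn E L} {A' : SmoothFn E L} (h : SmoothFnCurve A A')
    (V : VField E L) (x : L) :
    FnTangentAt x (fun t => LeviFlat.der V (A t)) (LeviFlat.der V A') := by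
  have h0 : A 0 = 0 := by
    ext y
    exact (h.tangentAt y).1
  refine ⟨congrArg (fun f : SmoothFn E L => f x) ((congrArg _ h0).trans (der_zero_right V)), ?_⟩
  let φ := extChartAt 𝓘(ℝ, E) x
  have key : ∀ f : SmoothFn E L, LeviFlat.der V f x =
      fderiv ℝ (fun z => f (φ.symm z)) (φ x) (V x) := by
    intro f
    rw [der_apply, (mdiff_fn f x).mvfderiv]
    simp only [modelWithCornersSelf_coe, Set.range_id, fderivWithin_univ]
    rfl
  have hG : ContDiffAt ℝ 2 (fun q : ℝ × E => A q.1 (φ.symm q.2)) (0, φ x) := by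
    have hs : ContMDiffAt 𝓘(ℝ, E) 𝓘(ℝ, E) ∞ φ.symm (φ x) :=
      (contMDiffOn_extChartAt_symm x).contMDiffAt (extChartAt_target_mem_nhds x)
    have hs' : ContMDiffAt (𝓘(ℝ, ℝ).prod 𝓘(ℝ, E)) (𝓘(ℝ, ℝ).prod 𝓘(ℝ, E)) ∞
        (fun q : ℝ × E => (q.1, φ.symm q.2)) (0, φ x) :=
      contMDiffAt_fst.prodMk (ContMDiffAt.comp (0, φ x) hs contMDiffAt_snd)
    have hx : φ.symm (φ x) = x := extChartAt_to_inv x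
    have hA := h.smooth x
    have hc : ContMDiffAt (𝓘(ℝ, ℝ).prod 𝓘(ℝ, E)) 𝓘(ℝ, ℝ) ∞
        (fun q : ℝ × E => A q.1 (φ.symm q.2)) (0, φ x) :=
      ContMDiffAt.comp (I' := 𝓘(ℝ, ℝ).prod 𝓘(ℝ, E)) (g := fun q : ℝ × L => A q.1 q.2) (0, φ x)
        (by simpa only [hx] using hA) hs'
    rw [← modelWithCornersSelf_prod, chartedSpaceSelf_prod] at hc
    exact hc.contDiffAt.of_le (WithTop.coe_le_coe.2 (le_top : (2 : ℕ∞) ≤ ⊤))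
  simp only [key]
  exact hasDerivAt_fderiv_of_contDiffAt hG
    (Eventually.of_forall fun z => (h.tangentAt (φ.symm z)).2) (V x)

/-! ### Separation by functions and local frames -/

variable [T2Space L]

/-- Every covector is the differential of a globally defined smooth function. -/
theorem exists_mvfderiv_eq (x : L) (ℓ : TangentSpace 𝓘(ℝ, E) x →L[ℝ] ℝ) :
    ∃ ψ : SmoothFn E L, mvfderiv 𝓘(ℝ, E) ψ x = ℓ := by
  let ℓ' : E →L[ℝ] ℝ := ℓ
  let f : SmoothBumpFunction 𝓘(ℝ, E) x := Classical.arbitrary _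
  have hs : ContMDiffOn 𝓘(ℝ, E) 𝓘(ℝ, ℝ) ∞ (fun y => ℓ' (extChartAt 𝓘(ℝ, E) x y))
      (chartAt E x).source :=
    ℓ'.contDiff.contMDiff.comp_contMDiffOn contMDiffOn_extChartAt
  refine ⟨⟨fun y => f y • ℓ' (extChartAt 𝓘(ℝ, E) x y), f.contMDiff_smul hs⟩, ?_⟩
  have he : (fun y => f y • ℓ' (extChartAt 𝓘(ℝ, E) x y)) =ᶠ[𝓝 x]
      (ℓ' ∘ extChartAt 𝓘(ℝ, E) x) := by
    filter_upwards [f.eventuallyEq_one] with y hy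
    simp [hy]
  have hm : MDifferentiableAt 𝓘(ℝ, E) 𝓘(ℝ, E) (extChartAt 𝓘(ℝ, E) x) x :=
    mdifferentiableAt_extChartAt (mem_chart_source E x)
  have h1 : mfderiv 𝓘(ℝ, E) 𝓘(ℝ, ℝ) (ℓ' ∘ extChartAt 𝓘(ℝ, E) x) x = ℓ' := by
    rw [mfderiv_comp x ℓ'.mdifferentiableAt hm, mfderiv_extChartAt_self,
      ℓ'.mfderiv_eq]
    rfl
  refine ContinuousLinearMap.ext fun v => ?_
  change mfderiv 𝓘(ℝ, E) 𝓘(ℝ, ℝ) (fun y => f y • ℓ' (extChartAt 𝓘(ℝ, E) x y)) x v = ℓ' v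
  rw [he.mfderiv_eq]
  exact congrArg (fun T : E →L[ℝ] ℝ => T v) h1

/-- Vector fields are determined by the derivatives of functions along them. -/
theorem VField.ext_der {V W : VField E L} (h : ∀ (ψ : SmoothFn E L) (x : L),
    der V ψ x = der W ψ x) : V = W := by
  ext x
  by_contra hne
  have hne' : @HSub.hSub E E E _ (V x) (W x) ≠ 0 := sub_ne_zero.2 hne
  obtain ⟨ℓ, hℓ⟩ := SeparatingDual.exists_ne_zero (V := E) (R := ℝ) hne'
  obtain ⟨ψ, hψ⟩ := exists_mvfderiv_eq x ℓ
  have := h ψ x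
  rw [der_apply, der_apply, hψ] at this
  exact hℓ ((map_sub ℓ (V x : E) (W x : E)).trans (sub_eq_zero.2 this))

theorem Foliation.finrank_ξ (F : Foliation E L) (x : L) :
    Module.finrank ℝ (F.ξ x) + 1 = Module.finrank ℝ E := by
  have : FiniteDimensional ℝ (TangentSpace 𝓘(ℝ, E) x) := inferInstanceAs (FiniteDimensional ℝ E)
  have h := Submodule.finrank_quotient_add_finrank (F.ξ x)
  rw [F.codim_one, add_comm] at h
  exact h

/-- A frame of `ξ` near `x`, in a global form: `f Q = ∑ⱼ (Q ψⱼ) eⱼ` for all sections `Q`, with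
`f(x) = 1`. -/
structure Foliation.Frame (F : Foliation E L) (x : L) where
  n : ℕ
  e : Fin n → F.Sec
  ψ : Fin n → SmoothFn E L
  f : SmoothFn E L
  f_apply : f x = 1
  expand : ∀ Q : F.Sec, f • Q = ∑ j, der Q.1 (ψ j) • e j

/-- Frames exist: the coordinates of a vector of `ξ` in a family of sections which is a basis at `x`
are computed by Cramer's rule from the derivatives of functions along it. -/
theorem Foliation.nonempty_frame (F : Foliation E L) (x : L) : Nonempty (F.Frame x) := by
  have fd : ∀ y : L, FiniteDimensional ℝ (TangentSpace 𝓘(ℝ, E) y) :=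
    fun y => inferInstanceAs (FiniteDimensional ℝ E)
  have t2 : T2Space (TangentSpace 𝓘(ℝ, E) x) := inferInstanceAs (T2Space E)
  let n := Module.finrank ℝ (F.ξ x)
  let b := Module.finBasis ℝ (F.ξ x)
  have hv : ∀ i, ∃ V : F.Sec, V.1 x = (b i : TangentSpace 𝓘(ℝ, E) x) := by
    intro i
    obtain ⟨V, hV, e⟩ := F.smooth x (b i) (b i).2
    exact ⟨⟨V, hV⟩, e⟩
  choose v hv using hv
  have hψ : ∀ i, ∃ ψ : SmoothFn E L, ∀ w : F.ξ x, mvfderiv 𝓘(ℝ, E) ψ x w = b.coord i w := by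
    intro i
    obtain ⟨ℓ, hℓ⟩ := LinearMap.exists_extend (b.coord i)
    obtain ⟨ψ, hψ⟩ := exists_mvfderiv_eq x (LinearMap.toContinuousLinearMap ℓ)
    refine ⟨ψ, fun w => ?_⟩
    rw [hψ]
    exact congrArg (fun T : F.ξ x →ₗ[ℝ] ℝ => T w) hℓ
  choose ψ hψ using hψ
  let A : Matrix (Fin n) (Fin n) (SmoothFn E L) := fun i j => der (v j).1 (ψ i)
  let ev : ∀ y : L, SmoothFn E L →+* ℝ := fun y => ContMDiffMap.evalRingHom y
  have hA : (ev x).mapMatrix A = 1 := by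
    ext i j
    change mvfderiv 𝓘(ℝ, E) (ψ i) x ((v j).1 x) = _
    rw [hv, hψ, Module.Basis.coord_apply, Module.Basis.repr_self, Matrix.one_apply,
      Finsupp.single_apply]
    simp only [eq_comm]
  have hdet : ∀ y, A.det y = ((ev y).mapMatrix A).det := fun y => (ev y).map_det A
  -- multiplying by the determinant once more gives an identity where the frame degenerates
  refine ⟨⟨n, fun j => ∑ i, (A.det * A.adjugate i j) • v i, ψ, A.det * A.det, ?_, fun Q => ?_⟩⟩
  · change A.det x * A.det x = 1
    rw [hdet, hA, Matrix.det_one, one_mul]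
  · refine Subtype.ext ?_
    ext y
    let M := (ev y).mapMatrix A
    let evS : F.Sec →+ E :=
      { toFun := fun Q => Q.1 y
        map_zero' := rfl
        map_add' := fun _ _ => rfl }
    have evS_smul : ∀ (g : SmoothFn E L) (R : F.Sec), evS (g • R) = g y • evS R := fun _ _ => rfl
    have hadj : ∀ i j, A.adjugate i j y = M.adjugate i j := fun i j =>
      congrArg (fun B : Matrix (Fin n) (Fin n) ℝ => B i j) ((ev y).map_adjugate A)
    change evS ((A.det * A.det) • Q) =
      evS (∑ j, der Q.1 (ψ j) • ∑ i, (A.det * A.adjugate i j) • v i)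
    simp only [map_sum, evS_smul, ContMDiffMap.coe_mul, Pi.mul_apply, hadj, hdet]
    change (M.det * M.det) • evS Q =
      ∑ j, der Q.1 (ψ j) y • ∑ i, (M.det * M.adjugate i j) • evS (v i)
    -- where the determinant is nonzero, the sections `v i` form a basis of `ξ` at `y`
    by_cases h0 : M.det = 0
    · simp [h0]
    let w : Fin n → F.ξ y := fun i => ⟨(v i).1 y, (v i).2 y⟩
    have hM : ∀ (g : Fin n → ℝ) (j : Fin n),
        mvfderiv 𝓘(ℝ, E) (ψ j) y (∑ i, g i • w i : F.ξ y) = M.mulVec g j := by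
      intro g j
      rw [Submodule.coe_sum, map_sum]
      refine Finset.sum_congr rfl fun i _ => ?_
      rw [Submodule.coe_smul, map_smul, smul_eq_mul, mul_comm]
      rfl
    have hw : LinearIndependent ℝ w := by
      rw [Fintype.linearIndependent_iff]
      intro g hg
      refine congrFun (Matrix.eq_zero_of_mulVec_eq_zero h0 (funext fun j => ?_))
      rw [← hM, hg, Submodule.coe_zero, map_zero]
      rfl
    have hcard : Fintype.card (Fin n) = Module.finrank ℝ (F.ξ y) := by
      have h1 := F.finrank_ξ x
      have h2 := F.finrank_ξ y
      rw [Fintype.card_fin]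
      omega
    have hspan : (⟨Q.1 y, Q.2 y⟩ : F.ξ y) ∈ Submodule.span ℝ (Set.range w) := by
      rcases isEmpty_or_nonempty (Fin n) with hn | hn
      · have : Subsingleton (F.ξ y) := by
          rw [← Module.finrank_zero_iff (R := ℝ), ← hcard, Fintype.card_eq_zero]
        rw [Subsingleton.elim (⟨Q.1 y, Q.2 y⟩ : F.ξ y) 0]
        exact zero_mem _
      · rw [hw.span_eq_top_of_card_eq_finrank hcard]
        trivial
    obtain ⟨g, hg⟩ := (Submodule.mem_span_range_iff_exists_fun ℝ).1 hspan
    have hQ : evS Q = ∑ i, g i • evS (v i) := by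
      have := congrArg Subtype.val hg
      rw [Submodule.coe_sum] at this
      exact this.symm
    have hd : ∀ j, der Q.1 (ψ j) y = M.mulVec g j := by
      intro j
      rw [← hM, hg]
      rfl
    have hg' : ∀ i, ∑ j, M.adjugate i j * M.mulVec g j = M.det * g i := by
      intro i
      have := congrFun (Matrix.mulVec_mulVec g M.adjugate M) i
      rw [Matrix.adjugate_mul, Matrix.smul_mulVec, Matrix.one_mulVec] at this
      exact this
    -- Cramer's rule
    simp only [hd, Finset.smul_sum, smul_smul]
    rw [Finset.sum_comm, hQ, Finset.smul_sum]
    refine Finset.sum_congr rfl fun i _ => ?_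
    rw [← Finset.sum_smul, smul_smul]
    congr 1
    rw [mul_assoc, ← hg', Finset.mul_sum]
    exact Finset.sum_congr rfl fun j _ => by ring

end Curves

section Tangent

open Filter Topology

variable {E : Type*} [NormedAddCommGroup E] [NormedSpace ℝ E] [FiniteDimensional ℝ E]
  {L : Type*} [TopologicalSpace L] [ChartedSpace E L] [IsManifold 𝓘(ℝ, E) ∞ L]

/-! ### Curves of sections of `ξ` -/

/-- `Q_t(x)` vanishes at `t = 0`, with derivative `Q'(x)`, for sections of `ξ`. -/
def SecTangentAt {F : Foliation E L} (x : L) (Q : ℝ → F.Sec) (Q' : F.Sec) : Prop :=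
  FieldTangentAt x (fun t => (Q t).1) Q'.1

namespace SecTangentAt

variable {F : Foliation E L} {x : L} {Q R : ℝ → F.Sec} {Q' R' : F.Sec}

theorem congr (hQ : SecTangentAt x Q Q') (h : ∀ t, R t = Q t) (h' : Q' = R') :
    SecTangentAt x R R' := by
  obtain rfl : R = Q := funext h
  exact h' ▸ hQ

theorem add (hQ : SecTangentAt x Q Q') (hR : SecTangentAt x R R') :
    SecTangentAt x (fun t => Q t + R t) (Q' + R') := fun ψ => by
  simpa only [Foliation.Sec.coe_add, der_add_left] using (hQ ψ).add (hR ψ)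

theorem neg (hQ : SecTangentAt x Q Q') : SecTangentAt x (fun t => -Q t) (-Q') := fun ψ => by
  simpa only [Foliation.Sec.coe_neg, der_neg_left] using (hQ ψ).neg

theorem sub (hQ : SecTangentAt x Q Q') (hR : SecTangentAt x R R') :
    SecTangentAt x (fun t => Q t - R t) (Q' - R') := by
  simpa only [sub_eq_add_neg] using hQ.add hR.neg

theorem fn_smul (f : SmoothFn E L) (hQ : SecTangentAt x Q Q') :
    SecTangentAt x (fun t => f • Q t) (f • Q') := fun ψ => by
  simpa only [Foliation.Sec.coe_smul, der_smul_left] using (hQ ψ).fn_mul f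

theorem real_smul (a : ℝ) (hQ : SecTangentAt x Q Q') :
    SecTangentAt x (fun t => a • Q t) (a • Q') :=
  (hQ.fn_smul (algebraMap ℝ (SmoothFn E L) a)).congr (fun _ => (algebraMap_smul _ _ _).symm)
    (algebraMap_smul _ _ _)

theorem smul_const {A : ℝ → SmoothFn E L} {A' : SmoothFn E L} (hA : FnTangentAt x A A')
    (V : F.Sec) : SecTangentAt x (fun t => A t • V) (A' • V) := fun ψ => by
  simpa only [Foliation.Sec.coe_smul, der_smul_left, mul_comm] using hA.fn_mul (der V.1 ψ)

/-- A product of curves through zero vanishes to second order. -/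
theorem smul {A : ℝ → SmoothFn E L} {A' : SmoothFn E L} (hA : FnTangentAt x A A')
    (hQ : SecTangentAt x Q Q') : SecTangentAt x (fun t => A t • Q t) 0 := fun ψ =>
  (hA.mul (hQ ψ)).congr
    (fun _ => by simp only [Foliation.Sec.coe_smul, der_smul_left])
    (congrArg (fun f : SmoothFn E L => f x) (der_zero_left ψ).symm)

variable [T2Space L]

end SecTangentAt

/-- The inclusion of `ℋ(ξ)` into the vector fields. -/
def Foliation.incl (F : Foliation E L) : F.Sec →ₗ[SmoothFn E L] VField E L :=
  (tangentFields F.ξ).subtype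

/-- At the point `x`, a `C^∞(L)`-linear functional is given by its values on the frame. -/
theorem Foliation.Frame.functional_apply {F : Foliation E L} {x : L} (fr : F.Frame x)
    (Θ : F.Sec →ₗ[SmoothFn E L] SmoothFn E L) (V : F.Sec) :
    Θ V x = (∑ j, der V.1 (fr.ψ j) * Θ (fr.e j)) x := by
  have h := congrArg Θ (fr.expand V)
  simp only [map_sum, map_smul, smul_eq_mul] at h
  rw [← h]
  change _ = fr.f x * Θ V x
  rw [fr.f_apply, one_mul]

/-- The value at `x` of a first-order operator on sections, in terms of the frame. -/
theorem Foliation.Frame.leibniz_apply {F : Foliation E L} {x : L} (fr : F.Frame x)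
    {B : F.Sec → F.Sec} {Y : VField E L} (hadd : ∀ V W, B (V + W) = B V + B W)
    (hsmul : ∀ (f : SmoothFn E L) V, B (f • V) = f • B V + der Y f • V) (V : F.Sec)
    (χ : SmoothFn E L) : der (B V).1 χ x =
      (∑ j, (der V.1 (fr.ψ j) * der (B (fr.e j)).1 χ + der Y (der V.1 (fr.ψ j)) * der (fr.e j).1 χ)
        - der Y fr.f * der V.1 χ) x := by
  have h : B (fr.f • V) = ∑ j, B (der V.1 (fr.ψ j) • fr.e j) :=
    (congrArg B (fr.expand V)).trans (map_sum (AddMonoidHom.mk' B hadd) _ _)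
  simp only [hsmul] at h
  have h' := congrArg (dFn χ ∘ₗ F.incl) h
  simp only [map_sum, map_add, map_smul, smul_eq_mul] at h'
  change fr.f * der (B V).1 χ + der Y fr.f * der V.1 χ = ∑ j, (der V.1 (fr.ψ j) *
    der (B (fr.e j)).1 χ + der Y (der V.1 (fr.ψ j)) * der (fr.e j).1 χ) at h'
  rw [← h', add_sub_cancel_right]
  change _ = fr.f x * der (B V).1 χ x
  rw [fr.f_apply, one_mul]

section Pointwise

variable [T2Space L] {F : Foliation E L} {x : L} {Q R : ℝ → F.Sec} {Q' R' : F.Sec}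

theorem SecTangentAt.functional (Θ : F.Sec →ₗ[SmoothFn E L] SmoothFn E L)
    (hQ : SecTangentAt x Q Q') : FnTangentAt x (fun t => Θ (Q t)) (Θ Q') := by
  obtain ⟨fr⟩ := F.nonempty_frame x
  refine FnTangentAt.congr (FnTangentAt.sum Finset.univ fun j =>
    (hQ (fr.ψ j)).fn_mul (Θ (fr.e j))) (fun t => ?_) ?_
  · simpa only [mul_comm] using fr.functional_apply Θ (Q t)
  · simpa only [mul_comm] using (fr.functional_apply Θ Q').symm

/-- A curve through zero of functionals, evaluated on a curve of sections through zero, vanishes to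
second order. -/
theorem SecTangentAt.functional_curve {Θ : ℝ → F.Sec →ₗ[SmoothFn E L] SmoothFn E L}
    {Θ' : F.Sec → SmoothFn E L} (hΘ : ∀ V, FnTangentAt x (fun t => Θ t V) (Θ' V))
    (hQ : SecTangentAt x Q Q') : FnTangentAt x (fun t => Θ t (Q t)) 0 := by
  obtain ⟨fr⟩ := F.nonempty_frame x
  refine FnTangentAt.congr (FnTangentAt.sum Finset.univ fun j =>
    (hQ (fr.ψ j)).mul (hΘ (fr.e j))) (fun t => fr.functional_apply (Θ t) (Q t)) ?_
  simp

/-- A `C^∞(L)`-linear endomorphism acts pointwise, hence commutes with time derivatives. -/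
theorem SecTangentAt.map (P : F.Sec →ₗ[SmoothFn E L] F.Sec) (hQ : SecTangentAt x Q Q') :
    SecTangentAt x (fun t => P (Q t)) (P Q') := fun χ =>
  hQ.functional (dFn χ ∘ₗ F.incl ∘ₗ P)

theorem SecTangentAt.map_curve {S : ℝ → F.Sec →ₗ[SmoothFn E L] F.Sec} {S' : F.Sec → F.Sec}
    (hS : ∀ V, SecTangentAt x (fun t => S t V) (S' V)) (hQ : SecTangentAt x Q Q') :
    SecTangentAt x (fun t => S t (Q t)) 0 := fun χ =>
  (hQ.functional_curve (Θ := fun t => dFn χ ∘ₗ F.incl ∘ₗ S t) (fun V => hS V χ)).congr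
    (fun _ => rfl) (congrArg (fun f : SmoothFn E L => f x) (der_zero_left χ).symm)

/-- A first-order operator applied to a smooth curve of sections. -/
theorem SecTangentAt.leibniz {B : F.Sec → F.Sec} {Y : VField E L}
    (hadd : ∀ V W, B (V + W) = B V + B W)
    (hsmul : ∀ (f : SmoothFn E L) V, B (f • V) = f • B V + der Y f • V)
    (hQ : SmoothFieldCurve (fun t => (Q t).1) Q'.1) :
    SecTangentAt x (fun t => B (Q t)) (B Q') := fun χ => by
  obtain ⟨fr⟩ := F.nonempty_frame x
  refine FnTangentAt.congr (((FnTangentAt.sum Finset.univ fun j =>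
    ((hQ.tangentAt x (fr.ψ j)).fn_mul (der (B (fr.e j)).1 χ)).add
      (((hQ (fr.ψ j)).der Y x).fn_mul (der (fr.e j).1 χ)))).sub
        ((hQ.tangentAt x χ).fn_mul (der Y fr.f))) (fun t => ?_) ?_
  · simpa only [mul_comm] using fr.leibniz_apply hadd hsmul (Q t) χ
  · simpa only [mul_comm] using (fr.leibniz_apply hadd hsmul Q' χ).symm

theorem SecTangentAt.bracket_left (V : F.Sec) (hQ : SmoothFieldCurve (fun t => (Q t).1) Q'.1) :
    SecTangentAt x (fun t => F.bracket V (Q t)) (F.bracket V Q') :=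
  SecTangentAt.leibniz (F.bracket_add_right V) (F.bracket_smul_right V) hQ

theorem SecTangentAt.bracket_right (W : F.Sec) (hQ : SmoothFieldCurve (fun t => (Q t).1) Q'.1) :
    SecTangentAt x (fun t => F.bracket (Q t) W) (F.bracket Q' W) :=
  SecTangentAt.leibniz (B := fun V => F.bracket V W) (Y := -W.1)
    (fun V V' => F.bracket_add_left V V' W)
    (fun f V => by rw [F.bracket_smul_left, der_neg_left]; module) hQ

/-- The bracket of two smooth curves of sections through zero vanishes to second order. -/
theorem SecTangentAt.bracket (hR : SmoothFieldCurve (fun t => (R t).1) R'.1)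
    (hQ : SmoothFieldCurve (fun t => (Q t).1) Q'.1) :
    SecTangentAt x (fun t => F.bracket (R t) (Q t)) 0 := fun χ => by
  obtain ⟨fr⟩ := F.nonempty_frame x
  have hR' : SecTangentAt x R R' := hR.tangentAt x
  have h : ∀ j, FnTangentAt x (fun t => der (R t).1 (der (Q t).1 (fr.ψ j))) 0 := fun j =>
    hR'.functional_curve (Θ := fun t => dFn (der (Q t).1 (fr.ψ j)) ∘ₗ F.incl)
      fun V => (hQ (fr.ψ j)).der V.1 x
  refine FnTangentAt.congr (((FnTangentAt.sum Finset.univ fun j =>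
    ((hQ.tangentAt x (fr.ψ j)).mul (SecTangentAt.bracket_right (fr.e j) hR χ)).add
      ((h j).fn_mul (der (fr.e j).1 χ)))).sub
        ((hR' fr.f).mul (hQ.tangentAt x χ))) (fun t => ?_) ?_
  · simpa only [mul_comm] using
      fr.leibniz_apply (F.bracket_add_right (R t)) (F.bracket_smul_right (R t)) (Q t) χ
  · have h0 : der (0 : F.Sec).1 χ = 0 := der_zero_left χ
    rw [h0]
    simp

end Pointwise

/-! ### Linearization of the Maurer-Cartan equations -/

namespace DefiningCouple

open LeviFlatStructure

variable {F : LeviFlatStructure E L} (c : DefiningCouple F.toFoliation)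

theorem bracketOf_eq (α : c.Z1) (V W : F.Sec) : c.bracketOf α V W =
    F.bracket V W + (α.1 V.1 • c.T c.X W - α.1 W.1 • c.T c.X V) := by
  have h : ∀ Z : VField E L, c.proj (Z + α.1 Z • c.X) = c.proj Z := by
    intro Z
    rw [map_add, map_smul, proj_X, smul_zero, add_zero]
  have e : lie (V.1 - α.1 V.1 • c.X) (W.1 - α.1 W.1 • c.X) =
      lie (V.1 + (-α.1 V.1) • c.X) (W.1 + (-α.1 W.1) • c.X) := by
    simp only [neg_smul, sub_eq_add_neg]
  have hb : c.proj (lie V.1 W.1) = F.bracket V W := c.proj_coe (F.bracket V W)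
  have hT : c.proj (lie c.X W.1) = -c.T c.X W := by rw [lie_swap, map_neg]; rfl
  have hT' : c.proj (lie V.1 c.X) = c.T c.X V := rfl
  rw [bracketOf, h, e]
  simp only [lie_add_left, lie_add_right, lie_smul_left, lie_smul_right, lie_self, map_add, map_sub,
    map_smul, map_zero, proj_X, smul_zero, hb, hT, hT']
  module

section Linearization

variable [T2Space L]

theorem lieForm_tangentAt {α : ℝ → OneForm E L} {β : OneForm E L}
    (hα : ∀ V, SmoothFnCurve (fun t => α t V) (β V)) (x : L) (X V : VField E L) :
    FnTangentAt x (fun t => lieForm X (α t) V) (lieForm X β V) :=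
  ((hα V).der X x).sub ((hα (lie X V)).tangentAt x)

/-- The linearization of `δα + ½ {α, α}` at `0` is `δ`. -/
theorem tangentAt_delta₁ {α : ℝ → c.Z1} {β : c.Z1}
    (hα : ∀ V, SmoothFnCurve (fun t => (α t).1 V) (β.1 V)) (x : L) (V W : VField E L) :
    FnTangentAt x (fun t => (c.delta₁ (α t) + (1 / 2 : ℝ) • braceForm c.X (α t).1 (α t).1) V W)
      (c.delta₁ β V W) := by
  have ha := fun V => (hα V).tangentAt x
  have hl := lieForm_tangentAt hα x c.X
  have h := ((((hα W).der V x).sub ((hα V).der W x)).sub (ha (lie V W))).add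
    ((((ha W).fn_mul (lieForm c.X c.γ V)).sub ((ha V).fn_mul (lieForm c.X c.γ W))).sub
      (((hl W).fn_mul (c.γ V)).sub ((hl V).fn_mul (c.γ W))))
  have hq := ((((hl V).mul (ha W)).sub ((hl W).mul (ha V))).sub
    (((ha V).mul (hl W)).sub ((ha W).mul (hl V)))).fn_mul (algebraMap ℝ (SmoothFn E L) (1 / 2))
  simp only [sub_self, mul_zero] at hq
  refine (h.add hq).congr (fun t => ?_) ?_
  · change (_ + (1 / 2 : ℝ) • _ : SmoothFn E L) x = _
    rw [Algebra.smul_def]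
    rfl
  · exact congrArg (fun f : SmoothFn E L => f x) (add_zero _)

variable {c}

theorem apply_J (S : F.Form01) (V : F.Sec) : F.J (S.1 V) = S.1 (-F.J V) := by
  rw [map_neg, S.2 V, neg_neg]

theorem T_tangentAt {Q : ℝ → F.Sec} {Q' : F.Sec} (x : L) (Y : VField E L)
    (hQ : SmoothFieldCurve (fun t => (Q t).1) Q'.1) :
    SecTangentAt x (fun t => c.T Y (Q t)) (c.T Y Q') :=
  SecTangentAt.leibniz (Y := -Y) (c.T_add Y)
    (fun f V => by rw [T_smul, der_neg_left]; module) hQ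

section Curve

variable {α : ℝ → c.Z1} {β : c.Z1} {S : ℝ → F.Form01} {P : F.Form01} {x : L}

theorem form_apply_tangentAt (hα : ∀ V, SmoothFnCurve (fun t => (α t).1 V) (β.1 V))
    (hS : ∀ V : F.Sec, SmoothFieldCurve (fun t => ((S t).1 V).1) (P.1 V).1) (V : F.Sec) :
    FnTangentAt x (fun t => (α t).1 ((S t).1 V).1) 0 :=
  SecTangentAt.functional_curve (Θ := fun t => (α t).1 ∘ₗ F.incl)
    (fun V => (hα V.1).tangentAt x) (Q := fun t => (S t).1 V) ((hS V).tangentAt x)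

theorem bracketOf_const_apply (hα : ∀ V, SmoothFnCurve (fun t => (α t).1 V) (β.1 V))
    (hS : ∀ V : F.Sec, SmoothFieldCurve (fun t => ((S t).1 V).1) (P.1 V).1) (V W : F.Sec) :
    SecTangentAt x (fun t => c.bracketOf (α t) V ((S t).1 W)) (F.bracket V (P.1 W)) :=
  ((SecTangentAt.bracket_left V (hS W)).add
    ((SecTangentAt.smul ((hα V.1).tangentAt x) (T_tangentAt x c.X (hS W))).sub
      (SecTangentAt.smul_const (form_apply_tangentAt hα hS W) (c.T c.X V)))).congr
    (fun _ => c.bracketOf_eq _ _ _) (by rw [zero_smul, sub_self, add_zero])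

theorem bracketOf_apply_const (hα : ∀ V, SmoothFnCurve (fun t => (α t).1 V) (β.1 V))
    (hS : ∀ V : F.Sec, SmoothFieldCurve (fun t => ((S t).1 V).1) (P.1 V).1) (V W : F.Sec) :
    SecTangentAt x (fun t => c.bracketOf (α t) ((S t).1 V) W) (F.bracket (P.1 V) W) :=
  ((SecTangentAt.bracket_right W (hS V)).add
    ((SecTangentAt.smul_const (form_apply_tangentAt hα hS V) (c.T c.X W)).sub
      (SecTangentAt.smul ((hα W.1).tangentAt x) (T_tangentAt x c.X (hS V))))).congr
    (fun _ => c.bracketOf_eq _ _ _) (by rw [zero_smul, sub_self, add_zero])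

theorem bracketOf_apply_apply (hα : ∀ V, SmoothFnCurve (fun t => (α t).1 V) (β.1 V))
    (hS : ∀ V : F.Sec, SmoothFieldCurve (fun t => ((S t).1 V).1) (P.1 V).1) (V W : F.Sec) :
    SecTangentAt x (fun t => c.bracketOf (α t) ((S t).1 V) ((S t).1 W)) 0 :=
  ((SecTangentAt.bracket (hS V) (hS W)).add
    ((SecTangentAt.smul (form_apply_tangentAt hα hS V) (T_tangentAt x c.X (hS W))).sub
      (SecTangentAt.smul (form_apply_tangentAt hα hS W) (T_tangentAt x c.X (hS V))))).congr
    (fun _ => c.bracketOf_eq _ _ _) (by rw [sub_self, add_zero])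

theorem bracketOf_const_const (hα : ∀ V, SmoothFnCurve (fun t => (α t).1 V) (β.1 V))
    (V W : F.Sec) : SecTangentAt x (fun t => c.bracketOf (α t) V W - F.bracket V W)
      (β.1 V.1 • c.T c.X W - β.1 W.1 • c.T c.X V) :=
  ((SecTangentAt.smul_const ((hα V.1).tangentAt x) (c.T c.X W)).sub
    (SecTangentAt.smul_const ((hα W.1).tangentAt x) (c.T c.X V))).congr
    (fun _ => by rw [bracketOf_eq, add_sub_cancel_left]) rfl

theorem apply_bracketOf (hα : ∀ V, SmoothFnCurve (fun t => (α t).1 V) (β.1 V))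
    (hS : ∀ V : F.Sec, SmoothFieldCurve (fun t => ((S t).1 V).1) (P.1 V).1) (V W : F.Sec) :
    SecTangentAt x (fun t => (S t).1 (c.bracketOf (α t) V W)) (P.1 (F.bracket V W)) :=
  (SecTangentAt.add (Q := fun t => (S t).1 (F.bracket V W)) ((hS _).tangentAt x)
    (SecTangentAt.map_curve (S := fun t => (S t).1) (fun V => (hS V).tangentAt x)
      (bracketOf_const_const hα V W))).congr
    (fun _ => by rw [← map_add, add_sub_cancel]) (add_zero _)

/-- The Nijenhuis tensor of `[·,·]_α` vanishes at `α = 0`, by integrability of `J`. -/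
theorem nijenhuis_const_const (hα : ∀ V, SmoothFnCurve (fun t => (α t).1 V) (β.1 V))
    (V W : F.Sec) :
    ∃ N : F.Sec, SecTangentAt x (fun t => nijenhuis F.J (c.bracketOf (α t)) V W) N := by
  refine ⟨_, ((((bracketOf_const_const hα (F.J V) (F.J W)).sub
    (bracketOf_const_const hα V W)).sub
    ((bracketOf_const_const hα (F.J V) W).map F.J)).sub
    ((bracketOf_const_const hα V (F.J W)).map F.J)).congr (fun t => ?_) rfl⟩
  rw [← sub_zero (nijenhuis F.J (c.bracketOf (α t)) V W), ← F.integrable V W]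
  simp only [nijenhuis, map_sub]
  abel

theorem nijenhuis_const_apply (hα : ∀ V, SmoothFnCurve (fun t => (α t).1 V) (β.1 V))
    (hS : ∀ V : F.Sec, SmoothFieldCurve (fun t => ((S t).1 V).1) (P.1 V).1) (V W : F.Sec) :
    SecTangentAt x (fun t => nijenhuis F.J (c.bracketOf (α t)) V ((S t).1 W)) 0 :=
  ((((bracketOf_const_apply hα hS (F.J V) (-F.J W)).sub (bracketOf_const_apply hα hS V W)).sub
    ((bracketOf_const_apply hα hS (F.J V) W).map F.J)).sub
    ((bracketOf_const_apply hα hS V (-F.J W)).map F.J)).congr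
    (fun t => by simp only [nijenhuis, apply_J])
    (by rw [← F.integrable V (P.1 W)]; simp only [nijenhuis, apply_J])

theorem nijenhuis_apply_const (hα : ∀ V, SmoothFnCurve (fun t => (α t).1 V) (β.1 V))
    (hS : ∀ V : F.Sec, SmoothFieldCurve (fun t => ((S t).1 V).1) (P.1 V).1) (V W : F.Sec) :
    SecTangentAt x (fun t => nijenhuis F.J (c.bracketOf (α t)) ((S t).1 V) W) 0 :=
  ((((bracketOf_apply_const hα hS (-F.J V) (F.J W)).sub (bracketOf_apply_const hα hS V W)).sub
    ((bracketOf_apply_const hα hS (-F.J V) W).map F.J)).sub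
    ((bracketOf_apply_const hα hS V (F.J W)).map F.J)).congr
    (fun t => by simp only [nijenhuis, apply_J])
    (by rw [← F.integrable (P.1 V) W]; simp only [nijenhuis, apply_J])

theorem nijenhuis_apply_apply (hα : ∀ V, SmoothFnCurve (fun t => (α t).1 V) (β.1 V))
    (hS : ∀ V : F.Sec, SmoothFieldCurve (fun t => ((S t).1 V).1) (P.1 V).1) (V W : F.Sec) :
    SecTangentAt x (fun t => nijenhuis F.J (c.bracketOf (α t)) ((S t).1 V) ((S t).1 W)) 0 :=
  ((((bracketOf_apply_apply hα hS (-F.J V) (-F.J W)).sub (bracketOf_apply_apply hα hS V W)).sub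
    ((bracketOf_apply_apply hα hS (-F.J V) W).map F.J)).sub
    ((bracketOf_apply_apply hα hS V (-F.J W)).map F.J)).congr
    (fun t => by simp only [nijenhuis, apply_J]) (by simp)

theorem dbarSection_tangentAt (hα : ∀ V, SmoothFnCurve (fun t => (α t).1 V) (β.1 V))
    (hS : ∀ V : F.Sec, SmoothFieldCurve (fun t => ((S t).1 V).1) (P.1 V).1) (V W : F.Sec) :
    SecTangentAt x (fun t => dbarSection F.J (c.bracketOf (α t)) ((S t).1 W) V)
      (dbarSection F.J F.bracket (P.1 W) V) :=
  (((bracketOf_const_apply hα hS V W).add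
    ((bracketOf_const_apply hα hS (F.J V) W).map F.J)).real_smul (1 / 2)).add
    ((nijenhuis_const_apply hα hS V W).real_smul (1 / 4)) |>.congr (fun _ => rfl)
    (by rw [dbarSection_eq, smul_zero, add_zero])

/-- The linearization of `∂̄^α S` at `0` is `∂̄`. -/
theorem dbarOneForm_tangentAt (hα : ∀ V, SmoothFnCurve (fun t => (α t).1 V) (β.1 V))
    (hS : ∀ V : F.Sec, SmoothFieldCurve (fun t => ((S t).1 V).1) (P.1 V).1) (V W : F.Sec) :
    SecTangentAt x (fun t => dbarOneForm F.J (c.bracketOf (α t)) (S t).1 V W)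
      (F.dbar₁ P V W) :=
  ((dbarSection_tangentAt hα hS V W).sub (dbarSection_tangentAt hα hS W V)).sub
    (((apply_bracketOf hα hS V W).sub (apply_bracketOf hα hS (F.J V) (F.J W))).real_smul
      (1 / 2)) |>.congr (fun t => by simp only [dbarOneForm, map_sub])
    (by simp only [dbar₁_apply, map_sub])

/-- The expression `[[S, S]]_α` vanishes to second order at `0`. -/
theorem doubleBracket_tangentAt (hα : ∀ V, SmoothFnCurve (fun t => (α t).1 V) (β.1 V))
    (hS : ∀ V : F.Sec, SmoothFieldCurve (fun t => ((S t).1 V).1) (P.1 V).1) (V W : F.Sec) :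
    SecTangentAt x (fun t => doubleBracket F.J (c.bracketOf (α t)) (S t).1 V W) 0 := by
  have hS' : ∀ V, SecTangentAt x (fun t => (S t).1 V) (P.1 V) := fun V => (hS V).tangentAt x
  obtain ⟨N, hN⟩ := nijenhuis_const_const (x := x) hα V W
  have h1 := SecTangentAt.map_curve (S := fun t => (S t).1) hS'
    ((((bracketOf_apply_const hα hS V W).add (bracketOf_const_apply hα hS V W)).add
      ((bracketOf_const_apply hα hS V (-F.J W)).map F.J)).add
      ((bracketOf_apply_const hα hS (-F.J V) W).map F.J))
  have h2 := (SecTangentAt.map_curve (S := fun t => (S t).1) hS'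
    (nijenhuis_apply_const hα hS V W)).add (SecTangentAt.map_curve (S := fun t => (S t).1) hS'
    (nijenhuis_const_apply hα hS V W))
  have h3 := SecTangentAt.map_curve (S := fun t => (S t).1) hS'
    (hN.sub (nijenhuis_apply_apply hα hS V W))
  refine (((((bracketOf_apply_apply hα hS V W).sub
    (bracketOf_apply_apply hα hS (-F.J V) (-F.J W))).sub h1).sub
    ((h2.sub (nijenhuis_apply_apply hα hS V W)).real_smul (1 / 2))).sub
    (h3.real_smul (1 / 2))).congr (fun t => ?_) ?_
  · simp only [doubleBracket, squareBracket, apply_J]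
  · simp

theorem wedge01_tangentAt (hα : ∀ V, SmoothFnCurve (fun t => (α t).1 V) (β.1 V)) (Q : F.Form01)
    (V W : F.Sec) :
    SecTangentAt x (fun t => wedge01 (α t).1 Q V W) (wedge01 β.1 Q V W) := by
  have ha := fun V : F.Sec => (hα V.1).tangentAt x
  have h : ∀ U V : F.Sec, SecTangentAt x (fun t => (tensor01 (α t).1 U).1 V)
      ((tensor01 β.1 U).1 V) := fun U V =>
    ((SecTangentAt.smul_const (ha V) U).add
      (SecTangentAt.smul_const (ha (F.J V)) (F.J U))).real_smul (1 / 2)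
  exact (h (Q.1 W) V).sub (h (Q.1 V) W)

end Curve

theorem smoothFnCurve_of_isMCCurve {a : ℝ} {lam : ℝ → c.Frak1} (h : c.IsMCCurve a lam)
    {β : OneForm E L}
    (hβ : ∀ (V : VField E L) (x : L), HasDerivAt (fun t => (lam t).1.1 V x) (β V x) 0)
    (V : VField E L) : SmoothFnCurve (fun t => (lam t).1.1 V) (β V) where
  tangentAt x := ⟨congrArg (fun p : c.Frak1 => p.1.1 V x) h.zero, hβ V x⟩
  smooth _ := (h.smooth_fst V).contMDiffAt
    (prod_mem_nhds (Icc_mem_nhds (neg_neg_of_pos h.pos) h.pos) univ_mem)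

theorem smoothFieldCurve_of_isMCCurve {a : ℝ} {lam : ℝ → c.Frak1} (h : c.IsMCCurve a lam)
    {P : F.Form01} (hP : ∀ (V : F.Sec) (x : L),
      HasDerivAt (fun t => (((lam t).2.1 V).1 x : TangentSpace 𝓘(ℝ, E) x)) ((P.1 V).1 x) 0)
    (V : F.Sec) : SmoothFieldCurve (fun t => ((lam t).2.1 V).1) (P.1 V).1 := fun ψ => by
  refine ⟨fun x => ⟨?_, ?_⟩, fun x => ?_⟩
  · exact (congrArg (fun p : c.Frak1 => der (p.2.1 V).1 ψ x) h.zero).trans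
      (congrArg (fun f : SmoothFn E L => f x) (der_zero_left ψ))
  · let T : E →L[ℝ] ℝ := mvfderiv 𝓘(ℝ, E) ψ x
    have h1 : HasDerivAt (F := E) (fun t => ((lam t).2.1 V).1 x) ((P.1 V).1 x) 0 := hP V x
    exact T.hasFDerivAt.comp_hasDerivAt (0 : ℝ) h1
  · have h1 : ContMDiff 𝓘(ℝ, E).tangent 𝓘(ℝ, ℝ).tangent ∞ (tangentMap 𝓘(ℝ, E) 𝓘(ℝ, ℝ) ψ) :=
      ψ.contMDiff.contMDiff_tangentMap (m := ∞) (by simp)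
    have h2 := h1.comp_contMDiffOn (h.smooth_snd V)
    have h3 := (contMDiff_snd_tangentBundle_modelSpace ℝ 𝓘(ℝ, ℝ) (n := ∞)).comp_contMDiffOn h2
    exact h3.contMDiffAt
      (prod_mem_nhds (Icc_mem_nhds (neg_neg_of_pos h.pos) h.pos) univ_mem)

/-- Differentiating the Maurer-Cartan equations at the origin gives the equations of `𝒜`. -/
theorem IsTangentVector.mem_calA {p : c.Frak1} (hp : c.IsTangentVector p) : p ∈ c.calA := by
  obtain ⟨a, lam, h, h1, h2⟩ := hp
  have hα := smoothFnCurve_of_isMCCurve h h1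
  have hS := smoothFieldCurve_of_isMCCurve h h2
  have hev : ∀ᶠ t in 𝓝 (0 : ℝ), lam t ∈ c.MC :=
    mem_of_superset (Icc_mem_nhds (neg_neg_of_pos h.pos) h.pos) h.mem
  refine ⟨LinearMap.ext₂ fun V W => ?_, LinearMap.ext₂ fun V W => ?_⟩
  · ext x
    refine (c.tangentAt_delta₁ hα x V W).unique FnTangentAt.zero (hev.mono fun t ht => ?_)
    rw [ht.1]
    rfl
  · refine Subtype.ext (VField.ext_der fun ψ x => ?_)
    have hl := ((dbarOneForm_tangentAt (x := x) hα hS V W).add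
      ((doubleBracket_tangentAt (x := x) hα hS V W).real_smul (1 / 2))) ψ
    rw [smul_zero, add_zero] at hl
    refine hl.unique ((wedge01_tangentAt hα c.H V W).neg ψ) (hev.mono fun t ht => ?_)
    exact congrArg (fun Z : F.Sec => der Z.1 ψ x) (ht.2 V W)

end Linearization

end DefiningCouple

end Tangent

end

end LeviFlat

theorem mainTheorem2 {E : Type*} [NormedAddCommGroup E] [NormedSpace ℝ E] [FiniteDimensional ℝ E]
    {L : Type*} [TopologicalSpace L] [T2Space L] [SecondCountableTopology L] [ChartedSpace E L]
    [IsManifold 𝓘(ℝ, E) ∞ L] (F : LeviFlat.LeviFlatStructure E L) (hF : F.IsExact) :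
    -- the tangent vectors of Maurer-Cartan curves lie in `𝒜`
    (∀ (c : LeviFlat.DefiningCouple F.toFoliation) (p : c.Frak1),
      c.IsTangentVector p → p ∈ c.calA) ∧
    -- couples with `H = 0`: the isomorphism and the injection are induced by the identity
    (∀ c : LeviFlat.DefiningCouple F.toFoliation, c.H = 0 →
      ∃ Φ : c.Moduli ≃ₗ[ℝ] c.H1delta × F.H1dbar,
        (∀ z : c.calA,
          LeviFlat.H1.IsClassOf c.delta₀ c.delta₁ z.1.1
            (Φ (c.modClass z)).1 ∧
          LeviFlat.H1.IsClassOf F.dbar₀ F.dbar₁ z.1.2 (Φ (c.modClass z)).2) ∧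
        ∃ ι : c.infDeformations → c.H1delta × F.H1dbar, Function.Injective ι ∧
          ∀ (h : c.infDeformations) (z : c.calA), c.frakClass z = h →
            ι h = Φ (c.modClass z)) ∧
    -- arbitrary couples: `H` is exact, and every primitive `U` of `H` gives an isomorphism
    (∀ c : LeviFlat.DefiningCouple F.toFoliation,
      (∃ U : F.Sec, c.H = c.beth₀ U) ∧
      ∀ U : F.Sec, c.H = c.beth₀ U →
        ∃ Φ : c.Moduli ≃ₗ[ℝ] c.H1delta × F.H1dbar,
          (∀ z : c.calA,
            LeviFlat.H1.IsClassOf c.delta₀ c.delta₁ z.1.1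
              (Φ (c.modClass z)).1 ∧
            LeviFlat.H1.IsClassOf F.dbar₀ F.dbar₁
              (z.1.2 - LeviFlat.LeviFlatStructure.tensor01 z.1.1.1 U)
              (Φ (c.modClass z)).2) ∧
          ∃ ι : c.infDeformations → c.H1delta × F.H1dbar, Function.Injective ι ∧
            ∀ (h : c.infDeformations) (z : c.calA), c.frakClass z = h →
              ι h = Φ (c.modClass z)) := by
  have hU : ∀ c : LeviFlat.DefiningCouple F.toFoliation, ∃ U : F.Sec, c.H = c.beth₀ U := by
    obtain ⟨c', h'⟩ := hF
    exact fun c => c.exists_eq_beth₀ c' h'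
  refine ⟨fun c p hp => hp.mem_calA, fun c hc => ?_, fun c => ⟨hU c, fun U h => ?_⟩⟩
  · -- `U = 0` is a primitive, and the twist by it is trivial
    have h0 : c.H = c.beth₀ 0 := by
      rw [LeviFlat.DefiningCouple.beth₀, map_zero, LeviFlat.LeviFlatStructure.tensor01_zero_right,
        sub_zero, hc]
    have hu : ∀ p : c.Frak1, c.untwist 0 p = p.2 := fun p => by
      rw [LeviFlat.DefiningCouple.untwist_apply,
        LeviFlat.LeviFlatStructure.tensor01_zero_right, sub_zero]
    simpa only [hu] using c.exists_moduli_equiv h0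
  · exact c.exists_moduli_equiv h
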